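/- All Banach spaces and Banach lattices are real, "operator" means bounded linear operator, $1\le p\le\infty$ and $\frac1p+\frac1{p^*}=1$. Let $X$ be a Banach lattice and $E$ a Banach space. Duals of Banach lattices are ordered by $f\le g$ iff $f(x)\le g(x)$ for all $x\ge 0$, and are again Banach lattices. For a sequence $(u_n)_n$ in a Banach space $F$ put $\|(u_n)_n\|_p=(\sum_n\|u_n\|^p)^{1/p}$ and $\|(u_n)_n\|_p^w=\sup_{\varphi\in F^*,\ \|\varphi\|\le1}(\sum_n|\varphi(u_n)|^p)^{1/p}$ (suprema over $n$ in place of sums if $p=\infty$), and let $\ell_p(F)$, $\ell_p^w(F)$ be the spaces of sequences for which these are finite. Definitions. * A Banach lattice $Y$ has the positive metric approximation property (PMAP) if for every $\varepsilon>0$ and every compact $K\subseteq Y$ there is a positive finite rank operator $R:Y\to Y$ with $\|R\|\le 1$ and $\|Ry-y\|<\varepsilon$ for all $y\in K$. * An operator $T:X\to E$ is positively $p$-nuclear if $Tx=\sum_{j=1}^\infty x_j^*(x)\,u_j$ for all $x\in X$, where $(x_j^*)_j\in\ell_{p^*}^w(X^*)$ with all $x_j^*\ge0$, and $(u_j)_j\in\ell_p(E)$;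 $\widetilde\nu^p(T)$ is the infimum of $\|(x_j^*)_j\|_{p^*}^w\,\|(u_j)_j\|_p$ over all such representations. * An operator $S:E\to X$ is latticially $p$-nuclear if $Su=\sum_{j=1}^\infty u_j^*(u)\,x_j$ for all $u\in E$, where $(u_j^*)_j\in\ell_p(E^*)$ and $(x_j)_j\in\ell_{p^*}^w(X)$ with all $x_j\ge0$; $\widetilde\nu_p(S)$ is the infimum of $\|(u_j^*)_j\|_p\,\|(x_j)_j\|_{p^*}^w$ over all such representations. * An operator $T:X\to E$ is positively $p$-integral if there is a constant $C\ge 0$ such that, for all Banach lattices $Y$, all Banach spaces $F$, all positive finite rank operators $S:Y\to X$ and all finite rank operators $R:E\to F$, the operator $RTS$ is positively $p$-nuclear with $\widetilde\nu^p(RTS)\le C\|R\|\|S\|$; $\widetilde i^p(T)$ is the infimum of such $C$. * An operator $S:E\to X$ is latticially $p$-integral if there is a constant $C\ge 0$ such that, for all Banach spaces $F$, all Banach lattices $Y$, all finite rank operators $A:F\to E$ and all positive finite rank operators $B:X\to Y$, the operator $BSA$ is latticially $p$-nuclear with $\widetilde\nu_p(BSA)\le C\|A\|\|B\|$; $\widetilde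 i_p(S)$ is the infimum of such $C$. Statement. Suppose that $X^*$ has the PMAP and let $T:X\to E$ be an operator. The following are equivalent: 1. $T:X\to E$ is positively $p$-integral; 2. $T^*:E^*\to X^*$ is latticially $p$-integral; 3. $T^{**}:X^{**}\to E^{**}$ is positively $p$-integral. In this case, $\widetilde i^p(T)=\widetilde i_p(T^*)=\widetilde i^p(T^{**})$. -/

import Mathlib

open scoped ENNReal NNReal

universe u v

/-! ### The dual of a Banach lattice, as a Banach lattice -/

namespace BanachLattice

section Dual

set_option linter.unusedSectionVars false

variable {X : Type*} [NormedAddCommGroup X] [NormedSpace ℝ X] [Lattice X]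

/-- The order of the dual: `f ≤ g` iff `f x ≤ g x` for all `x` in the positive cone. The positive
cone spans `X`, which gives antisymmetry. -/
instance dualPartialOrder [IsOrderedAddMonoid X] : PartialOrder (StrongDual ℝ X) where
  le f g := ∀ x : X, 0 ≤ x → f x ≤ g x
  le_refl f x _ := le_refl (f x)
  le_trans f g h h₁ h₂ x hx := (h₁ x hx).trans (h₂ x hx)
  le_antisymm f g h₁ h₂ := by
    ext x
    have hp := le_antisymm (h₁ _ (posPart_nonneg x)) (h₂ _ (posPart_nonneg x))
    have hn := le_antisymm (h₁ _ (negPart_nonneg x)) (h₂ _ (negPart_nonneg x))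
    rw [← posPart_sub_negPart x, map_sub, map_sub, hp, hn]

theorem dual_le_iff [IsOrderedAddMonoid X] {f g : StrongDual ℝ X} :
    f ≤ g ↔ ∀ x : X, 0 ≤ x → f x ≤ g x := Iff.rfl

theorem dual_nonneg_iff [IsOrderedAddMonoid X] {f : StrongDual ℝ X} :
    0 ≤ f ↔ ∀ x : X, 0 ≤ x → 0 ≤ f x := Iff.rfl

variable [IsOrderedAddMonoid X] [HasSolidNorm X]

theorem norm_le_of_mem_Icc {x y : X} (hy : 0 ≤ y) (hyx : y ≤ x) : ‖y‖ ≤ ‖x‖ := by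
  apply HasSolidNorm.solid
  rwa [abs_of_nonneg hy, abs_of_nonneg (hy.trans hyx)]

/-- The Riesz–Kantorovich formula `f⁺(x) = sup {f y : 0 ≤ y ≤ x}`, to be used for `0 ≤ x`. -/
noncomputable def rk (f : StrongDual ℝ X) (x : X) : ℝ := sSup (f '' Set.Icc 0 x)

theorem rk_bdd (f : StrongDual ℝ X) (x : X) : BddAbove (f '' Set.Icc 0 x) := by
  refine ⟨‖f‖ * ‖x‖, ?_⟩
  rintro _ ⟨y, hy, rfl⟩
  exact (le_abs_self _).trans ((f.le_opNorm y).trans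
    (mul_le_mul_of_nonneg_left (norm_le_of_mem_Icc hy.1 hy.2) (norm_nonneg f)))

theorem le_rk (f : StrongDual ℝ X) {x y : X} (hy : 0 ≤ y) (hyx : y ≤ x) : f y ≤ rk f x :=
  le_csSup (rk_bdd f x) ⟨y, ⟨hy, hyx⟩, rfl⟩

theorem rk_le (f : StrongDual ℝ X) {x : X} (hx : 0 ≤ x) {c : ℝ}
    (h : ∀ y, 0 ≤ y → y ≤ x → f y ≤ c) : rk f x ≤ c := by
  refine csSup_le ⟨f 0, 0, ⟨le_refl _, hx⟩, rfl⟩ ?_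
  rintro _ ⟨y, hy, rfl⟩
  exact h y hy.1 hy.2

theorem rk_nonneg (f : StrongDual ℝ X) {x : X} (hx : 0 ≤ x) : 0 ≤ rk f x := by
  simpa using le_rk f (le_refl (0 : X)) hx

theorem rk_add (f : StrongDual ℝ X) {x y : X} (hx : 0 ≤ x) (hy : 0 ≤ y) :
    rk f (x + y) = rk f x + rk f y := by
  apply le_antisymm
  · refine rk_le f (add_nonneg hx hy) fun z hz hzxy => ?_
    have h1 : f (z ⊓ x) ≤ rk f x := le_rk f (le_inf hz hx) inf_le_right
    have h2 : f (z - z ⊓ x) ≤ rk f y := by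
      refine le_rk f (sub_nonneg.2 inf_le_left) ?_
      rw [sub_le_iff_le_add, ← sub_le_iff_le_add']
      exact le_inf (sub_le_self _ hy) (by rwa [sub_le_iff_le_add])
    have h3 : f z = f (z ⊓ x) + f (z - z ⊓ x) := by rw [map_sub]; ring
    linarith
  · rw [← le_sub_iff_add_le]
    refine rk_le f hx fun a ha hax => ?_
    rw [le_sub_iff_add_le, ← le_sub_iff_add_le']
    refine rk_le f hy fun b hb hby => ?_
    have := le_rk f (add_nonneg ha hb) (add_le_add hax hby)
    rw [map_add] at this
    linarith

/-- The positive part of a functional. -/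
noncomputable def dualPos (f : StrongDual ℝ X) : StrongDual ℝ X :=
  let g : X →+ ℝ := AddMonoidHom.mk' (fun x => rk f x⁺ - rk f x⁻) (by
    intro x y
    have e : (x + y)⁺ + (x⁻ + y⁻) = (x⁺ + y⁺) + (x + y)⁻ := by
      have h1 := posPart_sub_negPart x
      have h2 := posPart_sub_negPart y
      have h3 := posPart_sub_negPart (x + y)
      rw [sub_eq_iff_eq_add] at h3
      rw [h3]
      nth_rw 1 [← h1, ← h2]
      abel
    have e' := congrArg (rk f) e
    rw [rk_add f (posPart_nonneg _) (add_nonneg (negPart_nonneg _) (negPart_nonneg _)),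
      rk_add f (negPart_nonneg _) (negPart_nonneg _),
      rk_add f (add_nonneg (posPart_nonneg _) (posPart_nonneg _)) (negPart_nonneg _),
      rk_add f (posPart_nonneg _) (posPart_nonneg _)] at e'
    linarith)
  g.toRealLinearMap (AddMonoidHomClass.continuous_of_bound g ‖f‖ (by
    intro x
    have hb : ∀ z : X, 0 ≤ z → z ≤ |x| → 0 ≤ rk f z ∧ rk f z ≤ ‖f‖ * ‖x‖ := by
      intro z hz hzx
      refine ⟨rk_nonneg f hz, rk_le f hz fun y hy hyz => ?_⟩
      refine (le_abs_self _).trans ((f.le_opNorm y).trans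
        (mul_le_mul_of_nonneg_left ?_ (norm_nonneg f)))
      rw [← norm_abs_eq_norm x]
      exact norm_le_of_mem_Icc hy (hyz.trans hzx)
    obtain ⟨h1, h2⟩ := hb x⁺ (posPart_nonneg x) (by
      rw [← posPart_add_negPart]; exact le_add_of_nonneg_right (negPart_nonneg x))
    obtain ⟨h3, h4⟩ := hb x⁻ (negPart_nonneg x) (by
      rw [← posPart_add_negPart]; exact le_add_of_nonneg_left (posPart_nonneg x))
    change |rk f x⁺ - rk f x⁻| ≤ _
    rw [abs_le]
    constructor <;> linarith))

theorem dualPos_apply (f : StrongDual ℝ X) {x : X} (hx : 0 ≤ x) : dualPos f x = rk f x := by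
  change rk f x⁺ - rk f x⁻ = rk f x
  rw [posPart_of_nonneg hx, negPart_of_nonneg hx]
  have h0 : rk f 0 = 0 := by
    have := rk_add f (le_refl (0 : X)) (le_refl 0)
    rw [add_zero] at this
    linarith
  rw [h0, sub_zero]

theorem dualPos_nonneg (f : StrongDual ℝ X) : 0 ≤ dualPos f := by
  intro x hx
  rw [dualPos_apply f hx]
  exact rk_nonneg f hx

theorem le_dualPos (f : StrongDual ℝ X) : f ≤ dualPos f := by
  intro x hx
  rw [dualPos_apply f hx]
  exact le_rk f hx le_rfl

theorem dualPos_le {f g : StrongDual ℝ X} (hfg : f ≤ g) (hg : 0 ≤ g) : dualPos f ≤ g := by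
  intro x hx
  rw [dualPos_apply f hx]
  refine rk_le f hx fun y hy hyx => (hfg y hy).trans ?_
  have := hg (x - y) (sub_nonneg.2 hyx)
  rw [map_sub] at this
  simpa using this

instance dualIsOrderedAddMonoid : IsOrderedAddMonoid (StrongDual ℝ X) where
  add_le_add_left f g h k x hx := by
    simpa using h x hx

instance dualIsOrderedModule : IsOrderedModule ℝ (StrongDual ℝ X) where
  smul_le_smul_of_nonneg_left a ha f g h x hx := by
    simpa using mul_le_mul_of_nonneg_left (h x hx) ha
  smul_le_smul_of_nonneg_right f hf a b hab x hx := by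
    have := hf x hx
    simpa using mul_le_mul_of_nonneg_right hab this

/-- The dual of a Banach lattice is a vector lattice. -/
noncomputable instance dualLattice : Lattice (StrongDual ℝ X) where
  __ := dualPartialOrder
  sup f g := f + dualPos (g - f)
  inf f g := f - dualPos (f - g)
  le_sup_left f g := le_add_of_nonneg_right (dualPos_nonneg _)
  le_sup_right f g := by
    rw [← sub_le_iff_le_add']
    exact le_dualPos _
  sup_le f g h hf hg := by
    rw [← le_sub_iff_add_le']
    exact dualPos_le (sub_le_sub_right hg f) (sub_nonneg.2 hf)
  inf_le_left f g := sub_le_self _ (dualPos_nonneg _)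
  inf_le_right f g := sub_le_comm.1 (le_dualPos _)
  le_inf f g h hg hh := by
    rw [le_sub_comm]
    exact dualPos_le (sub_le_sub_left hh _) (sub_nonneg.2 hg)

/-- The dual norm of a Banach lattice is a lattice norm. -/
instance dualHasSolidNorm : HasSolidNorm (StrongDual ℝ X) where
  solid f g h := by
    refine f.opNorm_le_bound (norm_nonneg g) fun x => ?_
    have hf : f ≤ |f| := le_abs_self f
    have hf' : -f ≤ |f| := neg_le_abs f
    have h1 : |f x| ≤ |f| |x| := by
      have a1 := hf _ (posPart_nonneg x)
      have a2 := hf _ (negPart_nonneg x)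
      have a3 := hf' _ (posPart_nonneg x)
      have a4 := hf' _ (negPart_nonneg x)
      have e : f x = f x⁺ - f x⁻ := by rw [← map_sub, posPart_sub_negPart]
      rw [← posPart_add_negPart x, map_add, e, abs_le]
      simp only [neg_apply] at a3 a4
      constructor <;> linarith
    have h2 : |f| |x| ≤ |g| |x| := h _ (abs_nonneg x)
    have h3 : |g| |x| ≤ ‖g‖ * ‖x‖ := by
      change (g + dualPos (-g - g)) |x| ≤ _
      rw [add_apply, dualPos_apply _ (abs_nonneg x), ← le_sub_iff_add_le']
      refine rk_le _ (abs_nonneg x) fun y hy hyx => ?_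
      have h4 : ‖|x| - y - y‖ ≤ ‖x‖ := by
        apply HasSolidNorm.solid
        refine abs_le'.2 ⟨(sub_le_self _ hy).trans (sub_le_self _ hy), ?_⟩
        · have : (0 : X) ≤ (|x| - y) + (|x| - y) :=
            add_nonneg (sub_nonneg.2 hyx) (sub_nonneg.2 hyx)
          have e : |x| - -(|x| - y - y) = (|x| - y) + (|x| - y) := by abel
          rwa [← sub_nonneg, e]
      have h5 := (le_abs_self _).trans ((g.le_opNorm (|x| - y - y)).trans
        (mul_le_mul_of_nonneg_left h4 (norm_nonneg g)))
      simp only [map_sub] at h5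
      simp only [sub_apply, neg_apply]
      linarith
    exact h1.trans (h2.trans h3)

end Dual

/-! ### Positive operators, finite rank operators, adjoints and the PMAP -/

section Operators

variable {X Y : Type*} [NormedAddCommGroup X] [NormedSpace ℝ X]
  [NormedAddCommGroup Y] [NormedSpace ℝ Y]

/-- Finite rank operators. -/
def IsFiniteRank (R : X →L[ℝ] Y) : Prop := FiniteDimensional ℝ (LinearMap.range (R : X →ₗ[ℝ] Y))

/-- Positive operators. -/
def IsPositiveOp [Lattice X] [Lattice Y] (R : X →L[ℝ] Y) : Prop := ∀ x : X, 0 ≤ x → 0 ≤ R x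

/-- The Banach space adjoint `T* : Y* → X*`, `T* φ = φ ∘ T`. -/
noncomputable def adj (T : X →L[ℝ] Y) : StrongDual ℝ Y →L[ℝ] StrongDual ℝ X := T.precomp ℝ

theorem adj_apply (T : X →L[ℝ] Y) (φ : StrongDual ℝ Y) (x : X) : adj T φ x = φ (T x) := rfl

/-- The positive metric approximation property. -/
def HasPMAP (X : Type*) [NormedAddCommGroup X] [NormedSpace ℝ X] [Lattice X] : Prop :=
  ∀ ε : ℝ, 0 < ε → ∀ K : Set X, IsCompact K →
    ∃ R : X →L[ℝ] X, IsPositiveOp R ∧ IsFiniteRank R ∧ ‖R‖ ≤ 1 ∧ ∀ x ∈ K, ‖R x - x‖ < ε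

end Operators

/-! ### Strongly and weakly `p`-summable sequences -/

section Sequences

variable {E : Type*} [NormedAddCommGroup E]

/-- The norm of `ℓ_p(E)`, with value `∞` for the sequences outside `ℓ_p(E)`; for `p = ∞` this is
the supremum norm. -/
noncomputable def seqNorm (p : ℝ≥0∞) (w : ℕ → E) : ℝ≥0∞ :=
  if p = ∞ then ⨆ n, ‖w n‖ₑ else (∑' n, ‖w n‖ₑ ^ p.toReal) ^ (1 / p.toReal)

/-- The norm of `ℓ_p^w(E)`, with value `∞` for the sequences outside `ℓ_p^w(E)`. -/
noncomputable def weakSeqNorm [NormedSpace ℝ E] (p : ℝ≥0∞) (w : ℕ → E) : ℝ≥0∞ :=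
  ⨆ (φ : StrongDual ℝ E) (_ : ‖φ‖ ≤ 1), seqNorm p (fun n => φ (w n))

end Sequences

/-! ### Positively and latticially `p`-nuclear operators -/

section Nuclear

variable {X : Type*} [NormedAddCommGroup X] [NormedSpace ℝ X] [Lattice X] [IsOrderedAddMonoid X]
  {E : Type*} [NormedAddCommGroup E] [NormedSpace ℝ E]

/-- `T = ∑ⱼ fⱼ ⊗ wⱼ : X → E` is a positively `p`-nuclear representation: the functionals `fⱼ` are
positive and form a weakly `p*`-summable sequence of `X*`, and `(wⱼ)` is in `ℓ_p(E)`. -/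
structure IsPosNuclearRep (p : ℝ≥0∞) (T : X →L[ℝ] E) (f : ℕ → StrongDual ℝ X) (w : ℕ → E) :
    Prop where
  nonneg : ∀ j, 0 ≤ f j
  weak : weakSeqNorm p.conjExponent f < ∞
  strong : seqNorm p w < ∞
  hasSum : ∀ x : X, HasSum (fun j => f j x • w j) (T x)

/-- The positively `p`-nuclear norm, with value `∞` if `T` is not positively `p`-nuclear. -/
noncomputable def posNuclearNorm (p : ℝ≥0∞) (T : X →L[ℝ] E) : ℝ≥0∞ :=
  ⨅ (f : ℕ → StrongDual ℝ X) (w : ℕ → E) (_ : IsPosNuclearRep p T f w),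
    weakSeqNorm p.conjExponent f * seqNorm p w

/-- `S = ∑ⱼ gⱼ ⊗ xⱼ : E → X` is a latticially `p`-nuclear representation: `(gⱼ)` is in `ℓ_p(E*)`,
and the vectors `xⱼ` are positive and form a weakly `p*`-summable sequence of `X`. -/
structure IsLatNuclearRep (p : ℝ≥0∞) (S : E →L[ℝ] X) (g : ℕ → StrongDual ℝ E) (x : ℕ → X) :
    Prop where
  nonneg : ∀ j, 0 ≤ x j
  strong : seqNorm p g < ∞
  weak : weakSeqNorm p.conjExponent x < ∞
  hasSum : ∀ e : E, HasSum (fun j => g j e • x j) (S e)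

/-- The latticially `p`-nuclear norm, with value `∞` if `S` is not latticially `p`-nuclear. -/
noncomputable def latNuclearNorm (p : ℝ≥0∞) (S : E →L[ℝ] X) : ℝ≥0∞ :=
  ⨅ (g : ℕ → StrongDual ℝ E) (x : ℕ → X) (_ : IsLatNuclearRep p S g x),
    seqNorm p g * weakSeqNorm p.conjExponent x

end Nuclear

/-! ### Positively and latticially `p`-integral operators -/

section Integral

variable {X : Type u} [NormedAddCommGroup X] [NormedSpace ℝ X] [Lattice X] [IsOrderedAddMonoid X]
  {E : Type v} [NormedAddCommGroup E] [NormedSpace ℝ E]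

/-- `C` is a constant witnessing that `T : X → E` is positively `p`-integral. (Where the right-hand
side is finite, as here, the inequality contains the claim that `RTS` is positively
`p`-nuclear.) -/
def PosIntegralBound (p : ℝ≥0∞) (T : X →L[ℝ] E) (C : ℝ≥0) : Prop :=
  ∀ (Y : Type u) [NormedAddCommGroup Y] [NormedSpace ℝ Y] [Lattice Y] [IsOrderedAddMonoid Y]
    [IsOrderedModule ℝ Y] [HasSolidNorm Y] [CompleteSpace Y]
    (F : Type v) [NormedAddCommGroup F] [NormedSpace ℝ F] [CompleteSpace F]
    (S : Y →L[ℝ] X) (R : E →L[ℝ] F), IsPositiveOp S → IsFiniteRank S → IsFiniteRank R →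
      posNuclearNorm p (R ∘L T ∘L S) ≤ C * ‖R‖ₑ * ‖S‖ₑ

/-- Positively `p`-integral operators. -/
def IsPosIntegral (p : ℝ≥0∞) (T : X →L[ℝ] E) : Prop := ∃ C : ℝ≥0, PosIntegralBound p T C

/-- The positively `p`-integral norm, with value `∞` if `T` is not positively `p`-integral. -/
noncomputable def posIntegralNorm (p : ℝ≥0∞) (T : X →L[ℝ] E) : ℝ≥0∞ :=
  ⨅ (C : ℝ≥0) (_ : PosIntegralBound p T C), (C : ℝ≥0∞)

/-- `C` is a constant witnessing that `S : E → X` is latticially `p`-integral. -/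
def LatIntegralBound (p : ℝ≥0∞) (S : E →L[ℝ] X) (C : ℝ≥0) : Prop :=
  ∀ (F : Type v) [NormedAddCommGroup F] [NormedSpace ℝ F] [CompleteSpace F]
    (Y : Type u) [NormedAddCommGroup Y] [NormedSpace ℝ Y] [Lattice Y] [IsOrderedAddMonoid Y]
    [IsOrderedModule ℝ Y] [HasSolidNorm Y] [CompleteSpace Y]
    (A : F →L[ℝ] E) (B : X →L[ℝ] Y), IsFiniteRank A → IsFiniteRank B → IsPositiveOp B →
      latNuclearNorm p (B ∘L S ∘L A) ≤ C * ‖A‖ₑ * ‖B‖ₑ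

/-- Latticially `p`-integral operators. -/
def IsLatIntegral (p : ℝ≥0∞) (S : E →L[ℝ] X) : Prop := ∃ C : ℝ≥0, LatIntegralBound p S C

/-- The latticially `p`-integral norm, with value `∞` if `S` is not latticially `p`-integral. -/
noncomputable def latIntegralNorm (p : ℝ≥0∞) (S : E →L[ℝ] X) : ℝ≥0∞ :=
  ⨅ (C : ℝ≥0) (_ : LatIntegralBound p S C), (C : ℝ≥0∞)

end Integral

end BanachLattice

/-! A constant `C` bounds `T` if and only if it bounds `T*`, if and only if it bounds `T**`. This is
proved by a cycle of implications that preserves `C`, so the infima agree as well. Only the passage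
from `T` to `T*` uses the PMAP.

From `T` to `T*`: let `A : F → E*` and `B : X* → Y` be the test operators. If a positive finite rank
contraction `S` on `X` has adjoint close to the identity on the range of `T*A`, the hypothesis makes
`A.flip ∘ T ∘ S : X → F*` positively nuclear. Transposing its representation represents `S*T*A`, but
the series converges only weak*. A second weak*-continuous finite rank operator `S'*` makes it
converge in norm, and the operator `B S'* S* T* A` differs from `B T* A` by finitely many small
rank-one terms. Such terms cost arbitrarily little in the nuclear norm (`HasRep.add_sum`).

The contractions `S` come from `exists_adj_approx`. The PMAP gives a positive finite rank `R` on
`X*`, which need not be an adjoint or a sum of positive rank-one operators. A Freudenthal-type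
bisection with band projections (`exists_approx_id`) brings `R` close to a sum of products of
positive elements of `X**` and `X*`. A Helly theorem for cones (`exists_mem_cone_approx`) then moves
the former into `X₊`, keeping the norm almost unchanged.

From `T*` to `T**`, the target may be taken finite dimensional. The same Helly theorem, with the
whole space as cone, replaces `R : E** → F` by a weak*-continuous operator, and reflexivity of `F`
turns the latticial representation into a positive one. From `T**` to `T`, one restricts to `X ⊆
X**`. -/

namespace BanachLattice

set_option linter.unusedSectionVars false

open Filter Topology

/-! ### Sequence norms -/

section SequenceNorms

variable {E F : Type*} [NormedAddCommGroup E] [NormedAddCommGroup F]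

/-- The sequence `x, w 0, w 1, …`. -/
def consSeq {α : Type*} (x : α) (w : ℕ → α) : ℕ → α
  | 0 => x
  | n + 1 => w n

theorem seqNorm_mono {p : ℝ≥0∞} {w : ℕ → E} {z : ℕ → F} (h : ∀ n, ‖w n‖ₑ ≤ ‖z n‖ₑ) :
    seqNorm p w ≤ seqNorm p z := by
  unfold seqNorm
  split_ifs
  · exact iSup_mono h
  · gcongr with n
    exact h n

theorem toReal_pos_of_one_le {p : ℝ≥0∞} (hp : 1 ≤ p) (h : p ≠ ∞) : 1 ≤ p.toReal := by
  simpa using ENNReal.toReal_mono h hp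

theorem seqNorm_smul [NormedSpace ℝ E] {p : ℝ≥0∞} (hp : 1 ≤ p) (c : ℝ) (w : ℕ → E) :
    seqNorm p (fun n => c • w n) = ‖c‖ₑ * seqNorm p w := by
  unfold seqNorm
  split_ifs with h
  · simp only [enorm_smul, ENNReal.mul_iSup]
  · have h1 := toReal_pos_of_one_le hp h
    simp only [enorm_smul]
    simp_rw [ENNReal.mul_rpow_of_nonneg _ _ (zero_le_one.trans h1)]
    rw [ENNReal.tsum_mul_left, ENNReal.mul_rpow_of_nonneg _ _ (by positivity),
      ← ENNReal.rpow_mul, mul_one_div_cancel (by positivity), ENNReal.rpow_one]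

/-- For `p ≥ 1` the `ℓ_p` sum of two numbers is at most their ordinary sum. This crude bound is
enough because every term prepended later is small. -/
theorem seqNorm_consSeq_le {p : ℝ≥0∞} (hp : 1 ≤ p) (x : E) (w : ℕ → E) :
    seqNorm p (consSeq x w) ≤ ‖x‖ₑ + seqNorm p w := by
  unfold seqNorm
  split_ifs with h
  · refine iSup_le fun n => ?_
    cases n with
    | zero => exact le_self_add
    | succ n => exact (le_iSup (fun n => ‖w n‖ₑ) n).trans le_add_self
  · have h1 := toReal_pos_of_one_le hp h
    rw [tsum_eq_zero_add' ENNReal.summable]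
    refine (ENNReal.rpow_add_le_add_rpow _ _ (by positivity) ?_).trans ?_
    · rw [one_div]; exact inv_le_one_of_one_le₀ h1
    · change (‖x‖ₑ ^ p.toReal) ^ (1 / p.toReal) + _ ≤ _
      rw [← ENNReal.rpow_mul, mul_one_div_cancel (by positivity), ENNReal.rpow_one]
      rfl

variable [NormedSpace ℝ E] [NormedSpace ℝ F]

theorem enorm_dual_le {φ : StrongDual ℝ E} (hφ : ‖φ‖ ≤ 1) (x : E) : ‖φ x‖ₑ ≤ ‖x‖ₑ :=
  enorm_le_iff_norm_le.2 ((φ.le_of_opNorm_le hφ x).trans_eq (one_mul _))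

theorem weakSeqNorm_consSeq_le {p : ℝ≥0∞} (hp : 1 ≤ p) (x : E) (w : ℕ → E) :
    weakSeqNorm p (consSeq x w) ≤ ‖x‖ₑ + weakSeqNorm p w := by
  refine iSup₂_le fun φ hφ => ?_
  have e : (fun n => φ (consSeq x w n)) = consSeq (φ x) (fun n => φ (w n)) := by
    ext n; cases n <;> rfl
  rw [e]
  exact (seqNorm_consSeq_le hp _ _).trans (add_le_add (enorm_dual_le hφ x)
    (le_iSup₂ (f := fun (φ : StrongDual ℝ E) (_ : ‖φ‖ ≤ 1) => seqNorm p fun n => φ (w n)) φ hφ))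

theorem weakSeqNorm_map_le {p : ℝ≥0∞} (hp : 1 ≤ p) (L : E →L[ℝ] F) (w : ℕ → E) :
    weakSeqNorm p (fun n => L (w n)) ≤ ‖L‖ₑ * weakSeqNorm p w := by
  refine iSup₂_le fun φ hφ => ?_
  have hn : ‖φ ∘L L‖ ≤ ‖L‖ := (φ.opNorm_comp_le L).trans (mul_le_of_le_one_left (norm_nonneg _) hφ)
  have h1 : ‖‖L‖⁻¹ • (φ ∘L L)‖ ≤ 1 := by
    rw [norm_smul, norm_inv, norm_norm]
    exact inv_mul_le_one_of_le₀ hn (norm_nonneg _)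
  have h2 : (fun n => φ (L (w n))) = fun n => ‖L‖ • (‖L‖⁻¹ • (φ ∘L L)) (w n) := by
    ext n
    by_cases h : ‖L‖ = 0
    · simp [norm_eq_zero.1 h]
    · simp [mul_inv_cancel_left₀ h]
  rw [h2, seqNorm_smul hp, enorm_norm]
  gcongr
  exact le_iSup₂ (f := fun (φ : StrongDual ℝ E) (_ : ‖φ‖ ≤ 1) => seqNorm p fun n => φ (w n)) _ h1

theorem weakSeqNorm_smul_le {p : ℝ≥0∞} (hp : 1 ≤ p) (c : ℝ) (w : ℕ → E) :
    weakSeqNorm p (fun n => c • w n) ≤ ‖c‖ₑ * weakSeqNorm p w := by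
  refine (weakSeqNorm_map_le hp (c • ContinuousLinearMap.id ℝ E) w).trans ?_
  gcongr
  rw [enorm_smul]
  refine mul_le_of_le_one_right' (enorm_le_iff_norm_le.2 ?_ |>.trans_eq (enorm_one (G := ℝ)))
  simpa using ContinuousLinearMap.norm_id_le (𝕜 := ℝ) (E := E)

theorem one_le_conjExponent (p : ℝ≥0∞) : 1 ≤ p.conjExponent := le_self_add

end SequenceNorms

/-! ### Nuclear representations with respect to a tensor map -/

section Representations

variable {P Q Z V : Type*} [NormedAddCommGroup P] [NormedSpace ℝ P] [Lattice P]
  [IsOrderedAddMonoid P] [NormedAddCommGroup Q] [NormedSpace ℝ Q]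
  [NormedAddCommGroup Z] [NormedSpace ℝ Z] [NormedAddCommGroup V] [NormedSpace ℝ V]

/-- `T = ∑ⱼ τ (aⱼ) (bⱼ)` pointwise, with `aⱼ ≥ 0`, `(aⱼ)` of weak `p*`-norm at most `α` and `(bⱼ)` of
strong `p`-norm at most `β`. -/
def HasRep (τ : P →L[ℝ] Q →L[ℝ] Z →L[ℝ] V) (p : ℝ≥0∞) (T : Z →L[ℝ] V) (α β : ℝ≥0) : Prop :=
  ∃ (a : ℕ → P) (b : ℕ → Q), (∀ j, 0 ≤ a j) ∧ weakSeqNorm p.conjExponent a ≤ α ∧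
    seqNorm p b ≤ β ∧ ∀ z, HasSum (fun j => τ (a j) (b j) z) (T z)

variable {τ : P →L[ℝ] Q →L[ℝ] Z →L[ℝ] V} {p : ℝ≥0∞} {T : Z →L[ℝ] V} {α β : ℝ≥0}

theorem HasRep.mono (h : HasRep τ p T α β) {α' β' : ℝ≥0} (hα : α ≤ α') (hβ : β ≤ β') :
    HasRep τ p T α' β' := by
  obtain ⟨a, b, h1, h2, h3, h4⟩ := h
  exact ⟨a, b, h1, h2.trans (by exact_mod_cast hα), h3.trans (by exact_mod_cast hβ), h4⟩

theorem HasRep.add (hp : 1 ≤ p) (h : HasRep τ p T α β) {x : P} (hx : 0 ≤ x) (y : Q) :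
    HasRep τ p (T + τ x y) (α + ‖x‖₊) (β + ‖y‖₊) := by
  obtain ⟨a, b, h1, h2, h3, h4⟩ := h
  refine ⟨consSeq x a, consSeq y b, ?_, ?_, ?_, fun z => ?_⟩
  · rintro (_ | j)
    exacts [hx, h1 j]
  · refine (weakSeqNorm_consSeq_le (one_le_conjExponent p) x a).trans ?_
    rw [add_comm, ENNReal.coe_add]
    exact add_le_add h2 le_rfl
  · refine (seqNorm_consSeq_le hp y b).trans ?_
    rw [add_comm, ENNReal.coe_add]
    exact add_le_add h3 le_rfl
  · rw [add_apply, add_comm]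
    exact HasSum.zero_add (f := fun j => τ (consSeq x a j) (consSeq y b j) z) (h4 z)

variable [IsOrderedModule ℝ P]

/-- Only the product of the two norms matters: scaling `x` to norm `δ` leaves the inversely scaled
`y` with norm at most `δ`. -/
theorem HasRep.add_of_norm_le (hp : 1 ≤ p) (h : HasRep τ p T α β) {x : P} (hx : 0 ≤ x) (y : Q)
    {δ : ℝ≥0} (hδ : 0 < δ) (hxy : ‖x‖₊ * ‖y‖₊ ≤ δ ^ 2) :
    HasRep τ p (T + τ x y) (α + δ) (β + δ) := by
  rcases eq_or_ne x 0 with rfl | hx0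
  · simpa using h.mono (le_self_add : α ≤ α + δ) (le_self_add : β ≤ β + δ)
  have hx1 : (0 : ℝ) < ‖x‖ := norm_pos_iff.2 hx0
  have hδ1 : (0 : ℝ) < δ := hδ
  have hxy1 : ‖x‖ * ‖y‖ ≤ δ ^ 2 := by exact_mod_cast hxy
  set t : ℝ := δ / ‖x‖ with ht
  have ht0 : 0 < t := by positivity
  have e : τ x y = τ (t • x) (t⁻¹ • y) := by
    simp [smul_smul, ht0.ne']
  rw [e]
  refine (h.add hp (smul_nonneg ht0.le hx) (t⁻¹ • y)).mono ?_ ?_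
  · gcongr
    rw [← NNReal.coe_le_coe, coe_nnnorm, norm_smul, Real.norm_of_nonneg ht0.le, ht,
      div_mul_cancel₀ _ hx1.ne']
  · gcongr
    rw [← NNReal.coe_le_coe, coe_nnnorm, norm_smul, Real.norm_of_nonneg (inv_nonneg.2 ht0.le), ht,
      inv_div, div_mul_eq_mul_div, div_le_iff₀ hδ1]
    linarith

/-- This absorbs finite rank errors without any sign condition. Each `x i` is split into positive
and negative parts, the sign of the latter moving to `y i`; hence two terms per index. -/
theorem HasRep.add_sum [HasSolidNorm P] (hp : 1 ≤ p) {ι : Type*} (s : Finset ι) (x : ι → P)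
    (y : ι → Q) {δ : ℝ≥0} (hδ : 0 < δ) (hxy : ∀ i ∈ s, ‖x i‖₊ * ‖y i‖₊ ≤ δ ^ 2)
    (h : HasRep τ p T α β) :
    HasRep τ p (T + ∑ i ∈ s, τ (x i) (y i)) (α + 2 * s.card * δ) (β + 2 * s.card * δ) := by
  classical
  induction s using Finset.induction_on with
  | empty => simpa using h
  | insert i s hi ih =>
    have h0 := ih fun j hj => hxy j (Finset.mem_insert_of_mem hj)
    have hi' := hxy i (Finset.mem_insert_self i s)
    have h1 := h0.add_of_norm_le hp (posPart_nonneg (x i)) (y i) hδ (le_trans (by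
      gcongr
      refine HasSolidNorm.solid ?_
      rw [abs_of_nonneg (posPart_nonneg _), ← posPart_add_negPart]
      exact le_add_of_nonneg_right (negPart_nonneg _)) hi')
    have h2 := h1.add_of_norm_le hp (negPart_nonneg (x i)) (-y i) hδ (le_trans (by
      rw [nnnorm_neg]
      gcongr
      refine HasSolidNorm.solid ?_
      rw [abs_of_nonneg (negPart_nonneg _), ← posPart_add_negPart]
      exact le_add_of_nonneg_left (posPart_nonneg _)) hi')
    have e : T + ∑ j ∈ insert i s, τ (x j) (y j)
        = T + ∑ j ∈ s, τ (x j) (y j) + τ (x i)⁺ (y i) + τ (x i)⁻ (-y i) := by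
      rw [Finset.sum_insert hi]
      nth_rewrite 1 [← posPart_sub_negPart (x i)]
      simp only [map_sub, map_neg, sub_apply]
      abel
    rw [e]
    refine h2.mono (le_of_eq ?_) (le_of_eq ?_) <;>
    · rw [Finset.card_insert_of_notMem hi]
      push_cast
      ring

theorem HasRep.smul (hp : 1 ≤ p) (h : HasRep τ p T α β) {t : ℝ≥0} (ht : 0 < t) :
    HasRep τ p T (t * α) (t⁻¹ * β) := by
  obtain ⟨a, b, h1, h2, h3, h4⟩ := h
  refine ⟨fun j => (t : ℝ) • a j, fun j => (t⁻¹ : ℝ) • b j,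
    fun j => smul_nonneg t.2 (h1 j), ?_, ?_, fun z => ?_⟩
  · refine (weakSeqNorm_smul_le (one_le_conjExponent p) _ _).trans ?_
    rw [ENNReal.coe_mul]
    gcongr
    simp
  · rw [seqNorm_smul hp, ENNReal.coe_mul]
    gcongr
    rw [← NNReal.coe_inv, Real.enorm_of_nonneg (NNReal.coe_nonneg _), ENNReal.ofReal_coe_nnreal]
  · have ht' : (t : ℝ) ≠ 0 := by exact_mod_cast ht.ne'
    simpa [smul_smul, ht'] using h4 z

theorem HasRep.normalize (hp : 1 ≤ p) (h : HasRep τ p T α β) {N : ℝ≥0} (hN : α * β < N) :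
    HasRep τ p T 1 N := by
  have hN0 : 0 < N := hN.pos
  -- When `α = 0` there is nothing to invert, but every rescaling keeps the first bound at `0`, so
  -- the factor only has to push `β` below `N`.
  rcases eq_or_ne α 0 with rfl | hα
  · have ht : 0 < β / N + 1 := by positivity
    refine (h.smul hp ht).mono (by simp) ?_
    rw [inv_mul_le_iff₀ ht, add_mul, div_mul_cancel₀ _ hN0.ne']
    exact le_self_add
  · have ht : 0 < α⁻¹ := by positivity
    refine (h.smul hp ht).mono (by rw [inv_mul_cancel₀ hα]) ?_
    rw [inv_inv]
    exact hN.le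

end Representations

/-! ### Translation between the two nuclear norms and representations. -/

section NuclearNorms

variable {X : Type*} [NormedAddCommGroup X] [NormedSpace ℝ X] [Lattice X] [IsOrderedAddMonoid X]
  {E : Type*} [NormedAddCommGroup E] [NormedSpace ℝ E] {p : ℝ≥0∞}

theorem IsLatNuclearRep.norm_le {S : E →L[ℝ] X} {g : ℕ → StrongDual ℝ E} {x : ℕ → X}
    (h : IsLatNuclearRep p S g x) :
    latNuclearNorm p S ≤ seqNorm p g * weakSeqNorm p.conjExponent x := by
  unfold latNuclearNorm
  exact iInf_le_of_le g (iInf_le_of_le x (iInf_le _ h))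

theorem IsPosNuclearRep.norm_le {T : X →L[ℝ] E} {f : ℕ → StrongDual ℝ X} {w : ℕ → E}
    (h : IsPosNuclearRep p T f w) :
    posNuclearNorm p T ≤ weakSeqNorm p.conjExponent f * seqNorm p w := by
  unfold posNuclearNorm
  exact iInf_le_of_le f (iInf_le_of_le w (iInf_le _ h))

/-- Used to discard inclusions of subspaces and the identification of a finite dimensional space
with its bidual. -/
theorem posNuclearNorm_comp_le {F : Type*} [NormedAddCommGroup F] [NormedSpace ℝ F]
    {T : X →L[ℝ] E} (L : E →L[ℝ] F) (hL : ‖L‖ ≤ 1) :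
    posNuclearNorm p (L ∘L T) ≤ posNuclearNorm p T := by
  refine le_iInf fun f => le_iInf fun w => le_iInf fun h => ?_
  have hw : seqNorm p (fun j => L (w j)) ≤ seqNorm p w :=
    seqNorm_mono fun n => enorm_le_iff_norm_le.2 ((L.le_of_opNorm_le hL _).trans_eq (one_mul _))
  refine (IsPosNuclearRep.norm_le (f := f) (w := fun j => L (w j))
    ⟨h.nonneg, h.weak, hw.trans_lt h.strong, fun x => ?_⟩).trans (by gcongr)
  simpa using L.hasSum (h.hasSum x)

theorem HasRep.latNuclearNorm_le {S : E →L[ℝ] X} {α β : ℝ≥0}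
    (h : HasRep (ContinuousLinearMap.smulRightL ℝ E X).flip p S α β) :
    latNuclearNorm p S ≤ α * β := by
  obtain ⟨x, g, h1, h2, h3, h4⟩ := h
  refine (IsLatNuclearRep.norm_le ⟨h1, h3.trans_lt ENNReal.coe_lt_top,
    h2.trans_lt ENNReal.coe_lt_top, h4⟩).trans ?_
  rw [mul_comm]
  gcongr

theorem hasRep_of_latNuclearNorm_lt [IsOrderedModule ℝ X] (hp : 1 ≤ p) {S : E →L[ℝ] X} {N : ℝ≥0}
    (h : latNuclearNorm p S < N) :
    HasRep (ContinuousLinearMap.smulRightL ℝ E X).flip p S 1 N := by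
  simp only [latNuclearNorm, iInf_lt_iff] at h
  obtain ⟨g, x, hr, h⟩ := h
  have hr' : HasRep (ContinuousLinearMap.smulRightL ℝ E X).flip p S
      (weakSeqNorm p.conjExponent x).toNNReal (seqNorm p g).toNNReal :=
    ⟨x, g, hr.nonneg, (ENNReal.coe_toNNReal hr.weak.ne).ge, (ENNReal.coe_toNNReal hr.strong.ne).ge,
      hr.hasSum⟩
  refine hr'.normalize hp ?_
  rw [← ENNReal.coe_lt_coe, ENNReal.coe_mul, ENNReal.coe_toNNReal hr.weak.ne,
    ENNReal.coe_toNNReal hr.strong.ne, mul_comm]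
  exact h

variable [HasSolidNorm X]

theorem HasRep.posNuclearNorm_le {T : X →L[ℝ] E} {α β : ℝ≥0}
    (h : HasRep (ContinuousLinearMap.smulRightL ℝ X E) p T α β) :
    posNuclearNorm p T ≤ α * β := by
  obtain ⟨f, w, h1, h2, h3, h4⟩ := h
  refine (IsPosNuclearRep.norm_le ⟨h1, h2.trans_lt ENNReal.coe_lt_top,
    h3.trans_lt ENNReal.coe_lt_top, h4⟩).trans ?_
  gcongr

theorem hasRep_of_posNuclearNorm_lt (hp : 1 ≤ p) {T : X →L[ℝ] E} {N : ℝ≥0}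
    (h : posNuclearNorm p T < N) :
    HasRep (ContinuousLinearMap.smulRightL ℝ X E) p T 1 N := by
  simp only [posNuclearNorm, iInf_lt_iff] at h
  obtain ⟨f, w, hr, h⟩ := h
  have hr' : HasRep (ContinuousLinearMap.smulRightL ℝ X E) p T
      (weakSeqNorm p.conjExponent f).toNNReal (seqNorm p w).toNNReal :=
    ⟨f, w, hr.nonneg, (ENNReal.coe_toNNReal hr.weak.ne).ge, (ENNReal.coe_toNNReal hr.strong.ne).ge,
      hr.hasSum⟩
  refine hr'.normalize hp ?_
  rw [← ENNReal.coe_lt_coe, ENNReal.coe_mul, ENNReal.coe_toNNReal hr.weak.ne,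
    ENNReal.coe_toNNReal hr.strong.ne]
  exact h

end NuclearNorms

/-! ### Band projections -/

section Band

variable {Λ : Type*} [NormedAddCommGroup Λ] [NormedSpace ℝ Λ] [Lattice Λ] [IsOrderedAddMonoid Λ]
  [IsOrderedModule ℝ Λ] [HasSolidNorm Λ]

/-- Gives subadditivity of the band projection `u ↦ sup_n (u ⊓ n • c)`; superadditivity comes from
`inf_add_inf_le_add_inf_add`. -/
theorem add_inf_le_inf_add_inf {u v c : Λ} (hu : 0 ≤ u) (hv : 0 ≤ v) (hc : 0 ≤ c) :
    (u + v) ⊓ c ≤ u ⊓ c + v ⊓ c := by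
  rw [add_inf, inf_add, inf_add]
  refine le_inf (le_inf inf_le_left ?_) (le_inf ?_ ?_) <;> refine inf_le_right.trans ?_
  exacts [le_add_of_nonneg_right hv, le_add_of_nonneg_left hu, le_add_of_nonneg_right hc]

theorem abs_sum_le_sum_abs {ι : Type*} (s : Finset ι) (f : ι → Λ) :
    |∑ i ∈ s, f i| ≤ ∑ i ∈ s, |f i| :=
  abs_le'.2 ⟨Finset.sum_le_sum fun i _ => le_abs_self (f i), by
    rw [← Finset.sum_neg_distrib]; exact Finset.sum_le_sum fun i _ => neg_le_abs (f i)⟩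

theorem inf_add_inf_le_add_inf_add {u v c d : Λ} : u ⊓ c + v ⊓ d ≤ (u + v) ⊓ (c + d) :=
  le_inf (add_le_add inf_le_left inf_le_left) (add_le_add inf_le_right inf_le_right)

theorem inf_nsmul_eq_zero {a b : Λ} (ha : 0 ≤ a) (hb : 0 ≤ b) (h : a ⊓ b = 0) (n : ℕ) :
    a ⊓ n • b = 0 := by
  induction n with
  | zero => simpa using ha
  | succ n ih =>
    refine le_antisymm ?_ (le_inf ha (nsmul_nonneg hb _))
    rw [succ_nsmul, inf_comm]
    refine (add_inf_le_inf_add_inf (nsmul_nonneg hb n) hb ha).trans ?_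
    rw [inf_comm, ih, inf_comm, h, add_zero]

/-- An additive map on the positive cone, dominated by the identity, extends to an operator. -/
theorem exists_clm_of_additive_on_cone (q : Λ → Λ)
    (hadd : ∀ u v, 0 ≤ u → 0 ≤ v → q (u + v) = q u + q v)
    (hq : ∀ u, 0 ≤ u → 0 ≤ q u ∧ q u ≤ u) : ∃ Q : Λ →L[ℝ] Λ, ∀ u, 0 ≤ u → Q u = q u := by
  let g : Λ →+ Λ := AddMonoidHom.mk' (fun x => q x⁺ - q x⁻) (by
    intro x y
    have e : (x + y)⁺ + (x⁻ + y⁻) = (x⁺ + y⁺) + (x + y)⁻ := by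
      have h1 := posPart_sub_negPart x
      have h2 := posPart_sub_negPart y
      have h3 := posPart_sub_negPart (x + y)
      rw [sub_eq_iff_eq_add] at h3
      rw [h3]
      nth_rw 1 [← h1, ← h2]
      abel
    have e' := congrArg q e
    rw [hadd _ _ (posPart_nonneg _) (add_nonneg (negPart_nonneg _) (negPart_nonneg _)),
      hadd _ _ (negPart_nonneg _) (negPart_nonneg _),
      hadd _ _ (add_nonneg (posPart_nonneg _) (posPart_nonneg _)) (negPart_nonneg _),
      hadd _ _ (posPart_nonneg _) (posPart_nonneg _)] at e'
    have e2 : q (x + y)⁺ = q x⁺ + q y⁺ + q (x + y)⁻ - (q x⁻ + q y⁻) := by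
      rw [← e']; abel
    rw [e2]
    abel)
  have hb : ∀ x, ‖g x‖ ≤ 1 * ‖x‖ := by
    intro x
    rw [one_mul]
    refine HasSolidNorm.solid ?_
    obtain ⟨h1, h2⟩ := hq x⁺ (posPart_nonneg x)
    obtain ⟨h3, h4⟩ := hq x⁻ (negPart_nonneg x)
    change |q x⁺ - q x⁻| ≤ |x|
    rw [← posPart_add_negPart x]
    refine abs_le'.2 ⟨(sub_le_self _ h3).trans (h2.trans (le_add_of_nonneg_right
      (negPart_nonneg x))), ?_⟩
    rw [neg_sub]
    exact (sub_le_self _ h1).trans (h4.trans (le_add_of_nonneg_left (posPart_nonneg x)))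
  refine ⟨g.toRealLinearMap (AddMonoidHomClass.continuous_of_bound g 1 hb), fun u hu => ?_⟩
  have h0 : q 0 = 0 := le_antisymm (hq 0 le_rfl).2 (hq 0 le_rfl).1
  change q u⁺ - q u⁻ = q u
  rw [posPart_of_nonneg hu, negPart_of_nonneg hu, h0, sub_zero]

end Band

/-! ### Band projections in the dual lattice. -/

section DualBand

variable {X : Type*} [NormedAddCommGroup X] [NormedSpace ℝ X] [Lattice X] [IsOrderedAddMonoid X]
  [HasSolidNorm X] [CompleteSpace X]

/-- The values on the positive cone are monotone and bounded, and the cone spans `X`. The limit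
functional is bounded by the uniform boundedness principle, which needs `X` complete. -/
theorem exists_tendsto_of_monotone {f : ℕ → StrongDual ℝ X} (hf : Monotone f) {g : StrongDual ℝ X}
    (hg : ∀ n, f n ≤ g) : ∃ F : StrongDual ℝ X, ∀ x, Tendsto (fun n => f n x) atTop (𝓝 (F x)) := by
  have h1 : ∀ x : X, 0 ≤ x → ∃ l, Tendsto (fun n => f n x) atTop (𝓝 l) := fun x hx =>
    ⟨_, tendsto_atTop_ciSup (fun n m hnm => hf hnm x hx)
      ⟨g x, by rintro _ ⟨n, rfl⟩; exact hg n x hx⟩⟩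
  have h2 : ∀ x : X, ∃ l, Tendsto (fun n => f n x) atTop (𝓝 l) := by
    intro x
    obtain ⟨a, ha⟩ := h1 _ (posPart_nonneg x)
    obtain ⟨b, hb⟩ := h1 _ (negPart_nonneg x)
    refine ⟨a - b, ?_⟩
    simpa only [← map_sub, posPart_sub_negPart] using ha.sub hb
  choose l hl using h2
  exact ⟨continuousLinearMapOfTendsto f (tendsto_pi_nhds.2 hl), hl⟩

/-- On the positive cone the projection onto the band of `c` is the pointwise limit of `u ⊓ n • c`.
It is additive there and lies between `0` and `u`, so it extends to an operator. -/
theorem exists_band_projection (c : StrongDual ℝ X) (hc : 0 ≤ c) :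
    ∃ Q : StrongDual ℝ X →L[ℝ] StrongDual ℝ X, (∀ u, 0 ≤ u → 0 ≤ Q u ∧ Q u ≤ u) ∧ Q c = c ∧
      ∀ u, 0 ≤ u → u ⊓ c = 0 → Q u = 0 := by
  have hmono : ∀ u : StrongDual ℝ X, Monotone fun n : ℕ => u ⊓ n • c := fun u n m hnm =>
    inf_le_inf_left u (nsmul_le_nsmul_left hc hnm)
  choose q hq using fun u : StrongDual ℝ X =>
    exists_tendsto_of_monotone (hmono u) (fun n => (inf_le_left : u ⊓ n • c ≤ u))
  have hle : ∀ u, q u ≤ u := fun u x hx =>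
    le_of_tendsto' (hq u x) fun n => (inf_le_left : u ⊓ n • c ≤ u) x hx
  have hnn : ∀ u, 0 ≤ u → 0 ≤ q u := fun u hu x hx =>
    ge_of_tendsto' (hq u x) fun n => (le_inf hu (nsmul_nonneg hc n) : 0 ≤ u ⊓ n • c) x hx
  have hadd : ∀ u v, 0 ≤ u → 0 ≤ v → q (u + v) = q u + q v := by
    intro u v hu hv
    refine le_antisymm (fun x hx => ?_) (fun x hx => ?_)
    · refine le_of_tendsto_of_tendsto' (hq (u + v) x) ((hq u x).add (hq v x)) fun n => ?_
      exact add_inf_le_inf_add_inf hu hv (nsmul_nonneg hc n) x hx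
    -- The sum of the two truncations at level `n` is bounded by a truncation at level `2n`, which
    -- has the same limit.
    · have h2 : Tendsto (fun n : ℕ => n + n) atTop atTop :=
        tendsto_atTop_mono (fun n => Nat.le_add_left n n) tendsto_id
      refine le_of_tendsto_of_tendsto' ((hq u x).add (hq v x)) ((hq (u + v) x).comp h2) fun n => ?_
      have h3 : u ⊓ n • c + v ⊓ n • c ≤ (u + v) ⊓ (n + n) • c := by
        rw [add_nsmul]; exact inf_add_inf_le_add_inf_add
      exact h3 x hx
  obtain ⟨Q, hQ⟩ := exists_clm_of_additive_on_cone q hadd fun u hu => ⟨hnn u hu, hle u⟩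
  refine ⟨Q, fun u hu => by rw [hQ u hu]; exact ⟨hnn u hu, hle u⟩, ?_, fun u hu huc => ?_⟩
  · rw [hQ c hc]
    refine le_antisymm (hle c) fun x hx => ge_of_tendsto (hq c x) ?_
    filter_upwards [eventually_ge_atTop 1] with n hn
    have : c ≤ c ⊓ n • c := le_inf le_rfl (le_self_nsmul hc (by omega))
    exact this x hx
  · rw [hQ u hu]
    ext x
    refine tendsto_nhds_unique (hq u x) ?_
    simp [inf_nsmul_eq_zero hu hc huc]

/-- For every functional `w` there is an operator `0 ≤ Q ≤ 1` with `Q w = w⁺`. -/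
theorem exists_clm_eq_posPart (w : StrongDual ℝ X) :
    ∃ Q : StrongDual ℝ X →L[ℝ] StrongDual ℝ X, (∀ u, 0 ≤ u → 0 ≤ Q u ∧ Q u ≤ u) ∧ Q w = w⁺ := by
  obtain ⟨Q, h1, h2, h3⟩ := exists_band_projection w⁺ (posPart_nonneg w)
  refine ⟨Q, h1, ?_⟩
  nth_rw 1 [← posPart_sub_negPart w]
  rw [map_sub, h2, h3 _ (negPart_nonneg w) (by rw [inf_comm]; exact posPart_inf_negPart_eq_zero w),
    sub_zero]

/-! ### Decompositions of the identity into positive operators -/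

/-- The identity is a finite sum of positive operators `Q` such that `Q ∘ P` satisfies `good`. -/
def HasDecomp (P : StrongDual ℝ X →L[ℝ] StrongDual ℝ X)
    (good : (StrongDual ℝ X →L[ℝ] StrongDual ℝ X) → Prop) : Prop :=
  ∃ (ι : Type) (_ : Fintype ι) (Q : ι → StrongDual ℝ X →L[ℝ] StrongDual ℝ X),
    (∀ i, IsPositiveOp (Q i)) ∧ ∑ i, Q i = ContinuousLinearMap.id ℝ _ ∧ ∀ i, good (Q i ∘L P)

/-- Decompositions can be refined piece by piece: substituting `id = ∑ k, R i k` into each piece `Q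
i` gives the pieces `R i k ∘ Q i`. -/
theorem HasDecomp.bind {P : StrongDual ℝ X →L[ℝ] StrongDual ℝ X}
    {g g' : (StrongDual ℝ X →L[ℝ] StrongDual ℝ X) → Prop} (h : HasDecomp P g)
    (h' : ∀ P', g P' → HasDecomp P' g') : HasDecomp P g' := by
  obtain ⟨ι, _, Q, h1, h2, h3⟩ := h
  choose κ hκ R h4 h5 h6 using fun i => h' _ (h3 i)
  refine ⟨Σ i, κ i, inferInstance, fun j => R j.1 j.2 ∘L Q j.1,
    fun j x hx => h4 _ _ _ (h1 _ _ hx), ?_, fun j => h6 j.1 j.2⟩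
  rw [Fintype.sum_sigma, ← h2]
  refine Finset.sum_congr rfl fun i _ => ?_
  have : ∑ k, R i k ∘L Q i = (∑ k, R i k) ∘L Q i := by
    ext; simp
  rw [this, h5]
  rfl

/-- A property stable under composition with positive operators on the left survives every further
refinement. -/
theorem HasDecomp.and {P : StrongDual ℝ X →L[ℝ] StrongDual ℝ X}
    {g h : (StrongDual ℝ X →L[ℝ] StrongDual ℝ X) → Prop} (hg : HasDecomp P g) (hP : h P)
    (hh : ∀ Q P', IsPositiveOp Q → h P' → h (Q ∘L P')) : HasDecomp P fun P' => h P' ∧ g P' := by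
  obtain ⟨ι, _, Q, h1, h2, h3⟩ := hg
  exact ⟨ι, inferInstance, Q, h1, h2, fun i => ⟨hh _ _ (h1 i) hP, h3 i⟩⟩

theorem hasDecomp_refl {P : StrongDual ℝ X →L[ℝ] StrongDual ℝ X}
    {g : (StrongDual ℝ X →L[ℝ] StrongDual ℝ X) → Prop} (h : g P) : HasDecomp P g :=
  ⟨Unit, inferInstance, fun _ => ContinuousLinearMap.id ℝ _, fun _ _ hx => hx, by simp,
    fun _ => by simpa using h⟩

theorem IsPositiveOp.apply_mono {Q : StrongDual ℝ X →L[ℝ] StrongDual ℝ X} (hQ : IsPositiveOp Q)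
    {u v : StrongDual ℝ X} (h : u ≤ v) : Q u ≤ Q v := by
  rw [← sub_nonneg, ← map_sub]
  exact hQ _ (sub_nonneg.2 h)

/-- On the image of `P`, the vector `v` is a multiple of `e` up to `d • e`. -/
def IsAlmostScalar (v e : StrongDual ℝ X) (d : ℝ)
    (P : StrongDual ℝ X →L[ℝ] StrongDual ℝ X) : Prop :=
  ∃ t : ℝ, t • P e ≤ P v ∧ P v ≤ (t + d) • P e

theorem IsAlmostScalar.comp {v e : StrongDual ℝ X} {d : ℝ}
    (Q P : StrongDual ℝ X →L[ℝ] StrongDual ℝ X) (hQ : IsPositiveOp Q)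
    (h : IsAlmostScalar v e d P) : IsAlmostScalar v e d (Q ∘L P) := by
  obtain ⟨t, h1, h2⟩ := h
  refine ⟨t, ?_, ?_⟩
  · simpa using hQ.apply_mono h1
  · simpa using hQ.apply_mono h2

/-- Bisection: project onto the band where `P v` exceeds its midpoint `(t + d / 2) • P e`. There `P
v` lies in the upper half of the order interval, and on the complementary piece in the lower half.
-/
theorem IsAlmostScalar.halve {v e : StrongDual ℝ X} {d : ℝ}
    {P : StrongDual ℝ X →L[ℝ] StrongDual ℝ X} (h : IsAlmostScalar v e d P) :
    HasDecomp P (IsAlmostScalar v e (d / 2)) := by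
  obtain ⟨t, h1, h2⟩ := h
  obtain ⟨Q, hQ, hw⟩ := exists_clm_eq_posPart (P v - (t + d / 2) • P e)
  have hQ1 : IsPositiveOp Q := fun u hu => (hQ u hu).1
  have hQ2 : IsPositiveOp (ContinuousLinearMap.id ℝ _ - Q) := fun u hu => by
    simpa using (hQ u hu).2
  refine ⟨Bool, inferInstance, fun b => if b then Q else ContinuousLinearMap.id ℝ _ - Q, ?_, ?_, ?_⟩
  · rintro (_ | _)
    exacts [hQ2, hQ1]
  · ext u x
    simp
  · rintro (_ | _)
    · refine ⟨t, by simpa using hQ2.apply_mono h1, ?_⟩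
      have : (ContinuousLinearMap.id ℝ (StrongDual ℝ X) - Q) (P v - (t + d / 2) • P e) ≤ 0 := by
        rw [sub_apply, hw, ContinuousLinearMap.id_apply]
        exact sub_nonpos.2 (le_posPart _)
      rw [map_sub, sub_nonpos, map_smul] at this
      exact this
    · refine ⟨t + d / 2, ?_, ?_⟩
      · have : 0 ≤ Q (P v - (t + d / 2) • P e) := by rw [hw]; exact posPart_nonneg _
        rw [map_sub, sub_nonneg, map_smul] at this
        exact this
      · have := hQ1.apply_mono h2
        rw [map_smul] at this
        rw [add_assoc, add_halves]
        exact this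

theorem IsAlmostScalar.hasDecomp {v e : StrongDual ℝ X} {d : ℝ}
    {P : StrongDual ℝ X →L[ℝ] StrongDual ℝ X} (h : IsAlmostScalar v e d P) (n : ℕ) :
    HasDecomp P (IsAlmostScalar v e (d / 2 ^ n)) := by
  induction n with
  | zero => exact hasDecomp_refl (by simpa using h)
  | succ n ih =>
    refine ih.bind fun P' h' => ?_
    have e1 : d / 2 ^ (n + 1) = d / 2 ^ n / 2 := by rw [pow_succ, div_div]
    rw [e1]
    exact h'.halve

/-- The vectors are treated one after another; cutting for a new one does not spoil the estimates
already obtained, since they persist under positive operators. -/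
theorem hasDecomp_family {ι : Type*} (s : Finset ι) (v : ι → StrongDual ℝ X) (e : StrongDual ℝ X)
    (hv : ∀ i ∈ s, |v i| ≤ e) (n : ℕ) :
    HasDecomp (ContinuousLinearMap.id ℝ (StrongDual ℝ X)) fun P =>
      IsPositiveOp P ∧ ∀ i ∈ s, IsAlmostScalar (v i) e (2 / 2 ^ n) P := by
  classical
  induction s using Finset.induction_on with
  | empty => exact hasDecomp_refl ⟨fun _ hx => hx, by simp⟩
  | insert a s ha ih =>
    refine (ih fun i hi => hv i (Finset.mem_insert_of_mem hi)).bind fun P hP => ?_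
    -- Bisection starts from the interval `[-e, e]`, which accounts for the `2` in `2 / 2 ^ n`.
    have h0 : IsAlmostScalar (v a) e 2 P := by
      obtain ⟨h1, h2⟩ := abs_le'.1 (hv a (Finset.mem_insert_self a s))
      refine ⟨-1, ?_, ?_⟩
      · have := hP.1.apply_mono h2
        rw [map_neg] at this
        exact (neg_one_smul ℝ (P e)).trans_le (neg_le.1 this)
      · norm_num
        exact hP.1.apply_mono h1
    obtain ⟨κ, hκ, Q, h1, h2, h3⟩ := (h0.hasDecomp n).and (h := fun P =>
      IsPositiveOp P ∧ ∀ i ∈ s, IsAlmostScalar (v i) e (2 / 2 ^ n) P) hP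
      fun Q P' hQ hP' => ⟨fun x hx => hQ _ (hP'.1 _ hx), fun i hi => (hP'.2 i hi).comp _ _ hQ⟩
    refine ⟨κ, hκ, Q, h1, h2, fun k => ⟨(h3 k).1.1, fun i hi => ?_⟩⟩
    rcases Finset.mem_insert.1 hi with rfl | hi
    exacts [(h3 k).2, (h3 k).1.2 i hi]

theorem exists_nonneg_apply_eq_one [IsOrderedModule ℝ X] {e : StrongDual ℝ X} (he : 0 ≤ e)
    (h0 : e ≠ 0) : ∃ x : X, 0 ≤ x ∧ e x = 1 := by
  have h1 : ∃ x : X, 0 ≤ x ∧ e x ≠ 0 := by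
    by_contra! h
    exact h0 (le_antisymm (fun x hx => (h x hx).le) he)
  obtain ⟨x, hx, hex⟩ := h1
  have := he x hx
  refine ⟨(e x)⁻¹ • x, smul_nonneg (inv_nonneg.2 this) hx, ?_⟩
  simp [hex]

variable [IsOrderedModule ℝ X]

/-- The identity of `X*` is approximated on finitely many vectors by a finite sum of products of
a functional, of the form `v ↦ Q v x` with `Q ≥ 0` and `x ≥ 0`, and a positive vector. -/
theorem exists_approx_id {ι : Type*} (s : Finset ι) (v : ι → StrongDual ℝ X) {ε : ℝ} (hε : 0 < ε) :
    ∃ (κ : Type) (_ : Fintype κ) (φ : κ → StrongDual ℝ (StrongDual ℝ X)) (e : κ → StrongDual ℝ X),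
      (∀ k, 0 ≤ φ k) ∧ (∀ k, 0 ≤ e k) ∧ ∀ i ∈ s, ‖v i - ∑ k, φ k (v i) • e k‖ ≤ ε := by
  set e : StrongDual ℝ X := ∑ i ∈ s, |v i| with he
  have he0 : 0 ≤ e := Finset.sum_nonneg fun i _ => abs_nonneg (v i)
  have hv : ∀ i ∈ s, |v i| ≤ e := fun i hi =>
    Finset.single_le_sum (f := fun i => |v i|) (fun j _ => abs_nonneg (v j)) hi
  obtain ⟨n, hn⟩ : ∃ n : ℕ, 2 / 2 ^ n * ‖e‖ ≤ ε := by
    obtain ⟨n, hn⟩ := pow_unbounded_of_one_lt (2 * ‖e‖ / ε) (one_lt_two (α := ℝ))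
    refine ⟨n, ?_⟩
    rw [div_lt_iff₀ hε] at hn
    rw [div_mul_eq_mul_div, div_le_iff₀ (by positivity)]
    linarith
  set d : ℝ := 2 / 2 ^ n with hd
  have hd0 : 0 ≤ d := by positivity
  obtain ⟨κ, hκ, Q, hQ, hsum, hgood⟩ := hasDecomp_family s v e hv n
  -- Evaluation at a point where `Q k e` equals `1` reads off a coefficient in `[t, t + d]` from the
  -- sandwich `t • Q k e ≤ Q k (v i) ≤ (t + d) • Q k e`, and it is linear in `v i`. If `Q k e = 0`,
  -- then `Q k (v i) = 0` too and any positive point serves.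
  have hx : ∀ k, ∃ x : X, 0 ≤ x ∧ (Q k e ≠ 0 → Q k e x = 1) := fun k => by
    by_cases h : Q k e = 0
    · exact ⟨0, le_rfl, fun h' => (h' h).elim⟩
    · obtain ⟨x, h1, h2⟩ := exists_nonneg_apply_eq_one (hQ k e he0) h
      exact ⟨x, h1, fun _ => h2⟩
  choose x hx0 hx1 using hx
  refine ⟨κ, hκ, fun k => NormedSpace.inclusionInDoubleDual ℝ X (x k) ∘L Q k, fun k => Q k e,
    fun k u hu => hQ k u hu (x k) (hx0 k), fun k => hQ k e he0, fun i hi => ?_⟩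
  have key : ∀ k, |Q k (v i) - (Q k (v i) (x k)) • Q k e| ≤ d • Q k e := by
    intro k
    obtain ⟨t, h1, h2⟩ := (hgood k).2 i hi
    simp only [ContinuousLinearMap.comp_id] at h1 h2
    by_cases h : Q k e = 0
    · rw [h, smul_zero] at h1 h2
      rw [le_antisymm h2 h1, h]
      simp
    · have a1 := h1 (x k) (hx0 k)
      have a2 := h2 (x k) (hx0 k)
      simp only [smul_apply, smul_eq_mul, hx1 k h, mul_one] at a1 a2
      have hk := hQ k e he0
      refine abs_le'.2 ⟨?_, ?_⟩
      · rw [sub_le_iff_le_add, ← add_smul]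
        exact h2.trans (smul_le_smul_of_nonneg_right (by linarith) hk)
      · rw [neg_sub, sub_le_iff_le_add, ← sub_le_iff_le_add']
        refine (sub_smul _ d (Q k e)).symm.trans_le ?_
        exact (smul_le_smul_of_nonneg_right (by linarith) hk).trans h1
  have e1 : ∀ u, u = ∑ k, Q k u := fun u => by
    rw [← sum_apply, hsum, ContinuousLinearMap.id_apply]
  -- The errors do not accumulate with the number of pieces, because the bounds `d • Q k e` add up
  -- to `d • e`.
  have e2 : |v i - ∑ k, Q k (v i) (x k) • Q k e| ≤ d • e := by
    nth_rw 1 [e1 (v i)]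
    rw [← Finset.sum_sub_distrib]
    refine (abs_sum_le_sum_abs _ _).trans ((Finset.sum_le_sum fun k _ => key k).trans_eq ?_)
    rw [← Finset.smul_sum, ← e1]
  have e3 : ‖v i - ∑ k, Q k (v i) (x k) • Q k e‖ ≤ ‖d • e‖ :=
    HasSolidNorm.solid (e2.trans (le_abs_self _))
  rw [norm_smul, Real.norm_of_nonneg hd0] at e3
  exact e3.trans hn

end DualBand

/-! ### Finite rank operators as finite sums -/

section FiniteRank

variable {X Y : Type*} [NormedAddCommGroup X] [NormedSpace ℝ X]
  [NormedAddCommGroup Y] [NormedSpace ℝ Y]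

theorem IsFiniteRank.exists_sum {R : X →L[ℝ] Y} (hR : IsFiniteRank R) :
    ∃ (n : ℕ) (a : Fin n → StrongDual ℝ X) (y : Fin n → Y), ∀ x, R x = ∑ i, a i x • y i := by
  have : FiniteDimensional ℝ (LinearMap.range (R : X →ₗ[ℝ] Y)) := hR
  let b := Module.finBasis ℝ (LinearMap.range (R : X →ₗ[ℝ] Y))
  let R' : X →L[ℝ] LinearMap.range (R : X →ₗ[ℝ] Y) :=
    R.codRestrict _ fun x => LinearMap.mem_range_self (R : X →ₗ[ℝ] Y) x
  refine ⟨_, fun i => LinearMap.toContinuousLinearMap (b.coord i) ∘L R', fun i => b i, fun x => ?_⟩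
  have h := congrArg Subtype.val (b.sum_repr (R' x))
  rw [Submodule.coe_sum] at h
  exact h.symm

theorem isFiniteRank_of_sum {ι : Type*} [Fintype ι] {R : X →L[ℝ] Y} (a : ι → X → ℝ) (y : ι → Y)
    (h : ∀ x, R x = ∑ i, a i x • y i) : IsFiniteRank R := by
  have h1 : LinearMap.range (R : X →ₗ[ℝ] Y) ≤ Submodule.span ℝ (Set.range y) := by
    rintro _ ⟨x, rfl⟩
    change R x ∈ _
    rw [h]
    exact Submodule.sum_mem _ fun i _ => Submodule.smul_mem _ _ (Submodule.subset_span ⟨i, rfl⟩)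
  have : FiniteDimensional ℝ (Submodule.span ℝ (Set.range y)) :=
    FiniteDimensional.span_of_finite ℝ (Set.finite_range y)
  exact Submodule.finiteDimensional_of_le h1

theorem IsFiniteRank.flip {W : Type*} [NormedAddCommGroup W] [NormedSpace ℝ W]
    {A : W →L[ℝ] StrongDual ℝ X} (hA : IsFiniteRank A) :
    IsFiniteRank (A.flip : X →L[ℝ] StrongDual ℝ W) := by
  obtain ⟨n, a, y, h⟩ := hA.exists_sum
  refine isFiniteRank_of_sum (fun i x => y i x) a fun x => ?_
  ext z
  simp [h, mul_comm]

theorem isFiniteRank_of_finiteDimensional [FiniteDimensional ℝ Y] (R : X →L[ℝ] Y) :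
    IsFiniteRank R :=
  inferInstanceAs (FiniteDimensional ℝ (LinearMap.range (R : X →ₗ[ℝ] Y)))

theorem norm_adj_le (T : X →L[ℝ] Y) : ‖adj T‖ ≤ ‖T‖ := by
  refine ContinuousLinearMap.opNorm_le_bound _ (norm_nonneg _) fun φ => ?_
  exact (φ.opNorm_comp_le T).trans_eq (mul_comm _ _)

end FiniteRank

/-! ### Helly's theorem for cones -/

section Helly

variable {W : Type*} [NormedAddCommGroup W] [NormedSpace ℝ W]

/-- For `l ≠ 0`, `θ l ≤ ‖θ‖ * ‖l‖ < c * ‖l‖`, and the last number is the supremum of `l` over the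
open ball of radius `c`. -/
theorem exists_norm_lt_le_apply {θ : StrongDual ℝ (StrongDual ℝ W)} {c : ℝ} (h : ‖θ‖ < c)
    (l : StrongDual ℝ W) : ∃ y : W, ‖y‖ < c ∧ θ l ≤ l y := by
  have hc : 0 < c := (norm_nonneg θ).trans_lt h
  rcases eq_or_ne l 0 with rfl | hl
  · exact ⟨0, by simpa using hc, by simp⟩
  have hl' : 0 < ‖l‖ := norm_pos_iff.2 hl
  have h1 : ‖θ‖ / c * ‖l‖ < ‖l‖ := mul_lt_of_lt_one_left hl' ((div_lt_one hc).2 h)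
  obtain ⟨y, hy, hly⟩ := l.exists_lt_apply_of_lt_opNorm h1
  have h2 : θ l ≤ c * |l y| := by
    refine (le_abs_self _).trans ((θ.le_opNorm l).trans ?_)
    have h3 := (mul_le_mul_of_nonneg_left hly.le hc.le)
    rw [← mul_assoc, mul_div_cancel₀ _ hc.ne'] at h3
    exact h3
  have h4 : ‖c • y‖ < c := by
    rw [norm_smul, Real.norm_of_nonneg hc.le]
    exact mul_lt_of_lt_one_right hc hy
  rcases le_total 0 (l y) with h5 | h5
  · exact ⟨c • y, h4, by rwa [map_smul, smul_eq_mul, ← abs_of_nonneg h5]⟩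
  · refine ⟨-(c • y), by rwa [norm_neg], ?_⟩
    rwa [map_neg, map_smul, smul_eq_mul, ← mul_neg, ← abs_of_nonpos h5]

variable {κ ι m : Type*} [Fintype κ] [Fintype ι] [Fintype m] (K : PointedCone ℝ W)

/-- If no such `x` existed, Hahn–Banach would separate the image of the cone from the open box of
admissible data. The separating functional induces `w k` nonnegative on `K`, so `∑ k, ψ k (w k) ≥
0`; but the box contains a point at which the functional is at least this sum, although it is
negative on the box. -/
theorem exists_mem_cone_approx {ψ : κ → StrongDual ℝ (StrongDual ℝ W)}
    (hψ : ∀ k w, (∀ x ∈ K, 0 ≤ w x) → 0 ≤ ψ k w) (a : ι → κ → ℝ) (c : ι → ℝ)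
    (hc : ∀ j, ‖∑ k, a j k • ψ k‖ < c j) (v : m → StrongDual ℝ W) {ε : ℝ} (hε : 0 < ε) :
    ∃ x : κ → W, (∀ k, x k ∈ K) ∧ (∀ j, ‖∑ k, a j k • x k‖ < c j) ∧
      ∀ i k, |v i (x k) - ψ k (v i)| < ε := by
  classical
  let Φ : (κ → W) →ₗ[ℝ] (m × κ → ℝ) × (ι → W) :=
    { toFun := fun x => (fun q => v q.1 (x q.2), fun j => ∑ k, a j k • x k)
      map_add' := fun x y => by
        ext <;> simp [Finset.sum_add_distrib]
      map_smul' := fun r x => by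
        refine Prod.ext ?_ ?_
        · ext q; simp
        · ext j; simp [Finset.smul_sum, smul_comm r] }
  let s : Set ((m × κ → ℝ) × (ι → W)) :=
    (Set.univ.pi fun q => Metric.ball (ψ q.2 (v q.1)) ε) ×ˢ
      (Set.univ.pi fun j => Metric.ball 0 (c j))
  have hs1 : Convex ℝ s := (convex_pi fun q _ => convex_ball _ _).prod
    (convex_pi fun j _ => convex_ball _ _)
  have hs2 : IsOpen s := (isOpen_set_pi Set.finite_univ fun q _ => Metric.isOpen_ball).prod
    (isOpen_set_pi Set.finite_univ fun j _ => Metric.isOpen_ball)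
  let C : Set (κ → W) := {x | ∀ k, x k ∈ K}
  have hC : Convex ℝ C := fun x hx y hy r t hr ht _ k =>
    K.add_mem (K.smul_mem hr (hx k)) (K.smul_mem ht (hy k))
  by_contra! hcon
  have hdisj : Disjoint s (Φ '' C) := by
    rw [Set.disjoint_right]
    rintro _ ⟨x, hx, rfl⟩ ⟨h1, h2⟩
    obtain ⟨i, k, hik⟩ := hcon x hx fun j => by simpa [Φ] using h2 j trivial
    have := h1 (i, k) trivial
    rw [mem_ball_iff_norm] at this
    exact absurd this (not_lt.2 hik)
  obtain ⟨f, u, hfs, hft⟩ := geometric_hahn_banach_open hs1 hs2 (hC.linear_image Φ) hdisj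
  have hu : u ≤ 0 := by simpa using hft (Φ 0) ⟨0, fun k => K.zero_mem, rfl⟩
  -- A functional bounded below on a cone is nonnegative there: a negative value could be scaled
  -- below the bound `u`.
  have hpos : ∀ x ∈ C, 0 ≤ f (Φ x) := by
    intro x hx
    by_contra! hneg
    have hr : 0 ≤ (u - 1) / f (Φ x) := (div_pos_of_neg_of_neg (by linarith) hneg).le
    have := hft (Φ (((u - 1) / f (Φ x)) • x)) ⟨_, fun k => K.smul_mem hr (hx k), rfl⟩
    rw [map_smul, map_smul, smul_eq_mul, div_mul_cancel₀ _ hneg.ne] at this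
    linarith
  let lam : m × κ → ℝ := fun q => f (Pi.single q 1, 0)
  let l : ι → StrongDual ℝ W := fun j => f ∘L ContinuousLinearMap.inr ℝ _ _ ∘L
    ContinuousLinearMap.single ℝ (fun _ : ι => W) j
  have hf : ∀ g, f g = ∑ q, lam q * g.1 q + ∑ j, l j (g.2 j) := by
    intro g
    have e1 : g = ContinuousLinearMap.inl ℝ _ _ g.1 + ContinuousLinearMap.inr ℝ _ _ g.2 := by
      simp
    have e2 : g.1 = ∑ q, g.1 q • Pi.single q (1 : ℝ) := by
      ext q; simp [Finset.sum_apply, Pi.single_apply]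
    have e3 : g.2 = ∑ j, Pi.single j (g.2 j) := by
      rw [Finset.univ_sum_single]
    conv_lhs => rw [e1, map_add, e2, e3]
    simp only [map_sum, map_smul]
    congr 1
    refine Finset.sum_congr rfl fun q _ => ?_
    rw [smul_eq_mul, mul_comm]
    rfl
  -- These are the components of the functional `f ∘ Φ` on `κ → W`.
  let w : κ → StrongDual ℝ W := fun k => ∑ i, lam (i, k) • v i + ∑ j, a j k • l j
  have hw : ∀ k, ∀ x ∈ K, 0 ≤ w k x := by
    intro k x hx
    have h1 := hpos (Pi.single k x) fun k' => by
      by_cases h : k' = k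
      · subst h; simpa using hx
      · simp [h]
    rw [hf, Fintype.sum_prod_type] at h1
    have e1 : ∀ j, ∑ k', a j k' • (Pi.single k x : κ → W) k' = a j k • x := by
      intro j
      rw [Finset.sum_eq_single k (fun b _ hb => by simp [hb]) (by simp)]
      simp
    have e2 : ∀ i, ∑ k', lam (i, k') * v i ((Pi.single k x : κ → W) k') = lam (i, k) * v i x := by
      intro i
      rw [Finset.sum_eq_single k (fun b _ hb => by simp [hb]) (by simp)]
      simp
    simp only [Φ, LinearMap.coe_mk, AddHom.coe_mk, e1, e2] at h1
    simpa [w] using h1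
  have hsum : 0 ≤ ∑ k, ψ k (w k) := Finset.sum_nonneg fun k _ => hψ k (w k) (hw k)
  choose y hy1 hy2 using fun j => exists_norm_lt_le_apply (hc j) (l j)
  -- The contradictory point has the exact values `ψ k (v i)` as scalar coordinates, and as vector
  -- coordinates the `y j`, which realise at least the values of `∑ k, a j k • ψ k` on `l j`.
  have hg := hfs (fun q => ψ q.2 (v q.1), y)
    ⟨fun q _ => Metric.mem_ball_self hε, fun j _ => by simpa using hy1 j⟩
  rw [hf] at hg
  have h5 : ∑ j, (∑ k, a j k • ψ k) (l j) ≤ ∑ j, l j (y j) := Finset.sum_le_sum fun j _ => hy2 j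
  have h6 : ∑ k, ψ k (w k)
      = ∑ q, lam q * ψ q.2 (v q.1) + ∑ j, (∑ k, a j k • ψ k) (l j) := by
    simp only [w, map_add, map_sum, map_smul, Finset.sum_add_distrib, sum_apply, smul_apply,
      smul_eq_mul]
    rw [Fintype.sum_prod_type, Finset.sum_comm]
    congr 1
    exact Finset.sum_comm
  linarith

/-- An operator norm bound amounts to infinitely many constraints, but the operator factors through
the bounded image of the unit ball of `U` in `κ → ℝ`. A finite net of that image reduces the bound
to finitely many. -/
theorem exists_mem_cone_approx_norm_le {U : Type*} [NormedAddCommGroup U] [NormedSpace ℝ U]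
    {ψ : κ → StrongDual ℝ (StrongDual ℝ W)}
    (hψ : ∀ k w, (∀ x ∈ K, 0 ≤ w x) → 0 ≤ ψ k w) (e : κ → StrongDual ℝ U) {C : ℝ} (hC0 : 0 ≤ C)
    (hC : ∀ w, ‖∑ k, ψ k w • e k‖ ≤ C * ‖w‖) (v : m → StrongDual ℝ W) {ε : ℝ} (hε : 0 < ε) :
    ∃ x : κ → W, (∀ k, x k ∈ K) ∧ ‖∑ k, (e k).smulRight (x k)‖ ≤ C + ε ∧
      ∀ i k, |v i (x k) - ψ k (v i)| < ε := by
  classical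
  -- `M` will bound `∑ k, ‖x k‖`, so passing from the net to the whole ball costs at most `δ * M ≤ ε
  -- / 2`.
  set M : ℝ := ∑ k, (‖ψ k‖ + 1) with hM
  have hM0 : 0 ≤ M := Finset.sum_nonneg fun k _ => by positivity
  set δ : ℝ := ε / (2 * (M + 1)) with hδ
  have hδ0 : 0 < δ := by positivity
  let ev : U →L[ℝ] κ → ℝ := ContinuousLinearMap.pi e
  have htb : TotallyBounded (ev '' Metric.closedBall 0 1) :=
    (((Metric.isBounded_closedBall (x := (0 : U)) (r := 1)).image ev).isCompact_closure
      ).totallyBounded.subset subset_closure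
  obtain ⟨t, htA, htf, hcov⟩ := Metric.finite_approx_of_totallyBounded htb δ hδ0
  have := htf.fintype
  -- Net points carry the operator norm constraint. The unit vectors are added only to keep each `‖x
  -- k‖` below `‖ψ k‖ + 1`.
  obtain ⟨x, hx1, hx2, hx3⟩ := exists_mem_cone_approx K hψ
    (Sum.elim (fun y : t => (y : κ → ℝ)) fun k => Pi.single k 1)
    (Sum.elim (fun _ => C + ε / 2) fun k => ‖ψ k‖ + 1) (by
      rintro (⟨y, hy⟩ | k)
      · obtain ⟨z, hz, rfl⟩ := htA hy
        rw [mem_closedBall_zero_iff] at hz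
        refine lt_of_le_of_lt ?_ (show C < C + ε / 2 by linarith)
        refine ContinuousLinearMap.opNorm_le_bound _ hC0 fun w => ?_
        have e1 : (∑ k, e k z • ψ k) w = (∑ k, ψ k w • e k) z := by
          simp [mul_comm]
        change ‖(∑ k, e k z • ψ k) w‖ ≤ _
        rw [e1]
        exact ((∑ k, ψ k w • e k).le_of_opNorm_le_of_le (hC w) hz).trans_eq (mul_one _)
      · simp only [Sum.elim_inr]
        rw [Finset.sum_eq_single k (fun b _ hb => by simp [hb]) (by simp)]
        simp) v hε
  refine ⟨x, hx1, ContinuousLinearMap.opNorm_le_of_unit_norm (by positivity) fun z hz => ?_, hx3⟩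
  obtain ⟨y, hy, hzy⟩ := Set.mem_iUnion₂.1 (hcov ⟨z, by simp [hz], rfl⟩)
  have h1 : ‖∑ k, y k • x k‖ < C + ε / 2 := hx2 (Sum.inl ⟨y, hy⟩)
  have h2 : ∀ k, ‖x k‖ ≤ ‖ψ k‖ + 1 := by
    intro k
    have := hx2 (Sum.inr k)
    simp only [Sum.elim_inr] at this
    rw [Finset.sum_eq_single k (fun b _ hb => by simp [hb]) (by simp)] at this
    simpa using this.le
  have h3 : ∀ k, |e k z - y k| ≤ δ := fun k =>
    (norm_le_pi_norm (ev z - y) k).trans (mem_ball_iff_norm.1 hzy).le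
  have e2 : (∑ k, (e k).smulRight (x k)) z = ∑ k, y k • x k + ∑ k, (e k z - y k) • x k := by
    rw [← Finset.sum_add_distrib, sum_apply]
    refine Finset.sum_congr rfl fun k _ => ?_
    rw [← add_smul, add_sub_cancel]
    rfl
  have h4 : ‖∑ k, (e k z - y k) • x k‖ ≤ δ * M := by
    rw [hM, Finset.mul_sum]
    refine norm_sum_le_of_le _ fun k _ => ?_
    rw [norm_smul]
    exact mul_le_mul (h3 k) (h2 k) (norm_nonneg _) hδ0.le
  have h5 : δ * M ≤ ε / 2 := by
    rw [hδ, div_mul_eq_mul_div, div_le_div_iff₀ (by positivity) two_pos]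
    nlinarith
  rw [e2]
  refine (norm_add_le _ _).trans ?_
  linarith

end Helly

/-! ### Weak* continuous positive approximations of the identity of `X*` -/

section Approximation

variable {X : Type*} [NormedAddCommGroup X] [NormedSpace ℝ X] [Lattice X] [IsOrderedAddMonoid X]
  [IsOrderedModule ℝ X] [HasSolidNorm X] [CompleteSpace X]

/-- The operator `f ↦ ∑ k, f (x k) • e k` is the adjoint of the positive finite rank operator `∑ k,
e k ⊗ x k` on `X`: the approximating operators of the PMAP can be taken weak* continuous. -/
theorem exists_adj_approx (hX : HasPMAP (StrongDual ℝ X)) {m : Type*} [Fintype m]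
    (v : m → StrongDual ℝ X) {ε : ℝ} (hε : 0 < ε) :
    ∃ (κ : Type) (_ : Fintype κ) (e : κ → StrongDual ℝ X) (x : κ → X), (∀ k, 0 ≤ e k) ∧
      (∀ k, 0 ≤ x k) ∧ ‖∑ k, (e k).smulRight (x k)‖ ≤ 1 ∧
      ∀ i, ‖∑ k, v i (x k) • e k - v i‖ ≤ ε := by
  set V : ℝ := ∑ i, ‖v i‖ with hV
  have hV0 : 0 ≤ V := Finset.sum_nonneg fun i _ => norm_nonneg _
  have hvV : ∀ i, ‖v i‖ ≤ V := fun i =>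
    Finset.single_le_sum (f := fun i => ‖v i‖) (fun j _ => norm_nonneg (v j)) (Finset.mem_univ i)
  set ε₁ : ℝ := ε / (4 * (V + 1)) with hε₁
  have hε₁0 : 0 < ε₁ := by positivity
  obtain ⟨R, hRpos, hRfin, hR1, hRv⟩ := hX ε₁ hε₁0 (Set.range v) (Set.finite_range v).isCompact
  obtain ⟨n, a, y, hR⟩ := hRfin.exists_sum
  set A : ℝ := ∑ j, ‖a j‖ with hA
  have hA0 : 0 ≤ A := Finset.sum_nonneg fun i _ => norm_nonneg _
  obtain ⟨κ, hκ, φ, e, hφ, he, hφe⟩ := exists_approx_id Finset.univ y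
    (show 0 < ε₁ / (A + 1) by positivity)
  -- Approximating the identity on the finitely many `y j` spanning the range of `R` approximates
  -- `R` in operator norm.
  have hRR : ∀ z, ‖R z - ∑ k, φ k (R z) • e k‖ ≤ ε₁ * ‖z‖ := by
    intro z
    have e1 : R z - ∑ k, φ k (R z) • e k = ∑ j, a j z • (y j - ∑ k, φ k (y j) • e k) := by
      simp only [hR z, map_sum, map_smul, smul_sub, Finset.sum_sub_distrib, Finset.smul_sum,
        Finset.sum_smul, smul_smul, smul_eq_mul]
      rw [Finset.sum_comm]
    rw [e1]
    calc ‖∑ j, a j z • (y j - ∑ k, φ k (y j) • e k)‖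
        ≤ ∑ j, ‖a j‖ * ‖z‖ * (ε₁ / (A + 1)) := norm_sum_le_of_le _ fun j _ => by
          rw [norm_smul]
          exact mul_le_mul ((a j).le_opNorm z) (hφe j (Finset.mem_univ j)) (norm_nonneg _)
            (by positivity)
      _ = ε₁ * ‖z‖ * (A / (A + 1)) := by
          rw [← Finset.sum_mul, ← Finset.sum_mul, ← hA]
          ring
      _ ≤ ε₁ * ‖z‖ := mul_le_of_le_one_right (by positivity)
          ((div_le_one (by positivity)).2 (by linarith))
  set D : ℝ := ∑ k, ‖e k‖ with hD
  have hD0 : 0 ≤ D := Finset.sum_nonneg fun i _ => norm_nonneg _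
  set ε₃ : ℝ := ε / (2 * (D + V + 1)) with hε₃
  have hε₃0 : 0 < ε₃ := by positivity
  obtain ⟨x, hx1, hx2, hx3⟩ := exists_mem_cone_approx_norm_le (PointedCone.positive ℝ X)
    (ψ := fun k => φ k ∘L R)
    (fun k w hw => hφ k _ (hRpos w fun x hx => hw x hx)) e (C := 1 + ε₁) (by positivity)
    (fun w => by
      have h1 := hRR w
      have h2 : ‖R w‖ ≤ ‖w‖ := (R.le_of_opNorm_le hR1 w).trans_eq (one_mul _)
      have h3 := norm_sub_le (R w) (R w - ∑ k, φ k (R w) • e k)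
      rw [sub_sub_cancel] at h3
      change ‖∑ k, φ k (R w) • e k‖ ≤ _
      linarith) v hε₃0
  -- The norm obtained so far is at most `1 + ε₁ + ε₃`; this factor restores a contraction and moves
  -- each `v i` by at most `(ε₁ + ε₃) * V`.
  set c : ℝ := (1 + ε₁ + ε₃)⁻¹ with hc
  have hc0 : 0 < c := by positivity
  have hc1 : c ≤ 1 := inv_le_one_of_one_le₀ (by linarith)
  have hc2 : 1 - c ≤ ε₁ + ε₃ := by
    have : c * (1 + ε₁ + ε₃) = 1 := inv_mul_cancel₀ (by positivity)
    nlinarith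
  refine ⟨κ, hκ, e, fun k => c • x k, he, fun k => smul_nonneg hc0.le (hx1 k), ?_, fun i => ?_⟩
  · have e1 : ∑ k, (e k).smulRight (c • x k) = c • ∑ k, (e k).smulRight (x k) := by
      ext z
      simp [Finset.smul_sum, smul_comm c]
    rw [e1, norm_smul, Real.norm_of_nonneg hc0.le, hc]
    exact inv_mul_le_one_of_le₀ hx2 (by positivity)
  · have h1 : ‖∑ k, v i (x k) • e k - ∑ k, φ k (R (v i)) • e k‖ ≤ ε₃ * D := by
      rw [← Finset.sum_sub_distrib, hD, Finset.mul_sum]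
      refine norm_sum_le_of_le _ fun k _ => ?_
      refine (congrArg norm (sub_smul (v i (x k)) (φ k (R (v i))) (e k)).symm).trans_le ?_
      rw [norm_smul]
      exact mul_le_mul_of_nonneg_right (hx3 i k).le (norm_nonneg _)
    have h2 := hRR (v i)
    have h3 := (hRv (v i) ⟨i, rfl⟩).le
    have h4 := hvV i
    have e1 : ∑ k, v i (c • x k) • e k - v i
        = c • (∑ k, v i (x k) • e k - ∑ k, φ k (R (v i)) • e k)
          - c • (R (v i) - ∑ k, φ k (R (v i)) • e k) + c • (R (v i) - v i) - (1 - c) • v i := by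
      have : ∑ k, v i (c • x k) • e k = c • ∑ k, v i (x k) • e k := by
        simp [Finset.smul_sum, smul_smul]
      rw [this]
      module
    have hcn : ∀ z : StrongDual ℝ X, ‖c • z‖ ≤ ‖z‖ := fun z => by
      rw [norm_smul, Real.norm_of_nonneg hc0.le]
      exact mul_le_of_le_one_left (norm_nonneg _) hc1
    have h5 : ‖(1 - c) • v i‖ ≤ (ε₁ + ε₃) * V := by
      rw [norm_smul, Real.norm_of_nonneg (by linarith)]
      exact mul_le_mul hc2 h4 (norm_nonneg _) (by positivity)
    have h6 : ε₁ * ‖v i‖ ≤ ε₁ * V := mul_le_mul_of_nonneg_left h4 hε₁0.le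
    have h7 : ε₁ * (4 * (V + 1)) = ε := div_mul_cancel₀ _ (by positivity)
    have h8 : ε₃ * (2 * (D + V + 1)) = ε := div_mul_cancel₀ _ (by positivity)
    rw [e1]
    have t1 := norm_sub_le (c • (∑ k, v i (x k) • e k - ∑ k, φ k (R (v i)) • e k)
          - c • (R (v i) - ∑ k, φ k (R (v i)) • e k) + c • (R (v i) - v i)) ((1 - c) • v i)
    have t2 := norm_add_le (c • (∑ k, v i (x k) • e k - ∑ k, φ k (R (v i)) • e k)
          - c • (R (v i) - ∑ k, φ k (R (v i)) • e k)) (c • (R (v i) - v i))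
    have t3 := norm_sub_le (c • (∑ k, v i (x k) • e k - ∑ k, φ k (R (v i)) • e k))
          (c • (R (v i) - ∑ k, φ k (R (v i)) • e k))
    have u1 := hcn (∑ k, v i (x k) • e k - ∑ k, φ k (R (v i)) • e k)
    have u2 := hcn (R (v i) - ∑ k, φ k (R (v i)) • e k)
    have u3 := hcn (R (v i) - v i)
    nlinarith

end Approximation

set_option maxSynthPendingDepth 3

/-! ### Comparison of the integral bounds of `T`, `T*` and `T**` -/

theorem le_coe_of_forall_pos {x : ℝ≥0∞} {g : ℝ≥0 → ℝ≥0} (hg : Continuous g)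
    (h : ∀ δ, 0 < δ → x ≤ g δ) : x ≤ g 0 := by
  have h1 : Tendsto (fun δ => (g δ : ℝ≥0∞)) (𝓝[>] 0) (𝓝 (g 0)) :=
    ((ENNReal.continuous_coe.comp hg).tendsto 0).mono_left nhdsWithin_le_nhds
  exact ge_of_tendsto h1 (eventually_mem_nhdsWithin.mono fun δ hδ => h δ hδ)

/-! ### Reflexivity and weak convergence in finite dimension. -/

section FiniteDimensionalDual

variable (F : Type*) [NormedAddCommGroup F] [NormedSpace ℝ F] [FiniteDimensional ℝ F]

/-- A finite dimensional space is reflexive. -/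
noncomputable def doubleDualEquiv : F ≃ₗᵢ[ℝ] StrongDual ℝ (StrongDual ℝ F) :=
  (NormedSpace.inclusionInDoubleDualLi ℝ).toLinearIsometryEquiv (by
    have h : ∀ (G : Type _) [NormedAddCommGroup G] [NormedSpace ℝ G] [FiniteDimensional ℝ G],
        Module.finrank ℝ (StrongDual ℝ G) = Module.finrank ℝ G := fun G _ _ _ =>
      (LinearMap.toContinuousLinearMap (𝕜 := ℝ) (E := G) (F' := ℝ)).finrank_eq.symm.trans
        Subspace.dual_finrank_eq
    have : Module.finrank ℝ (StrongDual ℝ (StrongDual ℝ F)) = Module.finrank ℝ (StrongDual ℝ F) :=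
      (LinearMap.toContinuousLinearMap (𝕜 := ℝ) (E := StrongDual ℝ F) (F' := ℝ)).finrank_eq.symm.trans
        Subspace.dual_finrank_eq
    rw [this, h])

theorem doubleDualEquiv_apply (y : F) (φ : StrongDual ℝ F) : doubleDualEquiv F y φ = φ y := rfl

theorem apply_doubleDualEquiv_symm (g : StrongDual ℝ (StrongDual ℝ F)) (φ : StrongDual ℝ F) :
    φ ((doubleDualEquiv F).symm g) = g φ := by
  rw [← doubleDualEquiv_apply, LinearIsometryEquiv.apply_symm_apply]

variable {F}

theorem hasSum_of_forall_dual {f : ℕ → F} {y : F}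
    (h : ∀ φ : StrongDual ℝ F, HasSum (fun j => φ (f j)) (φ y)) : HasSum f y := by
  let b := Module.finBasis ℝ F
  have h1 := hasSum_sum (s := Finset.univ) fun k _ =>
    (h (LinearMap.toContinuousLinearMap (b.coord k))).smul_const (b k)
  have h2 : ∀ z, ∑ k, LinearMap.toContinuousLinearMap (b.coord k) z • b k = z := b.sum_repr
  simpa only [h2] using h1

end FiniteDimensionalDual

theorem enorm_flip {W X : Type*} [NormedAddCommGroup W] [NormedSpace ℝ W] [NormedAddCommGroup X]
    [NormedSpace ℝ X] (A : W →L[ℝ] StrongDual ℝ X) : ‖A.flip‖ₑ = ‖A‖ₑ :=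
  le_antisymm (enorm_le_iff_norm_le.2 A.opNorm_flip.le) (enorm_le_iff_norm_le.2 A.opNorm_flip.ge)

/-! ### The cycle of implications, constant by constant. -/

section Bounds

variable {X : Type u} [NormedAddCommGroup X] [NormedSpace ℝ X] [Lattice X] [IsOrderedAddMonoid X]
  {E : Type v} [NormedAddCommGroup E] [NormedSpace ℝ E] {p : ℝ≥0∞} {C : ℝ≥0}

/-- `R` factors through its range with no larger norm, so finite dimensional, hence reflexive,
targets suffice. -/
theorem posIntegralBound_of_finiteDimensional {T : X →L[ℝ] E}
    (h : ∀ (Y : Type u) [NormedAddCommGroup Y] [NormedSpace ℝ Y] [Lattice Y] [IsOrderedAddMonoid Y]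
      [IsOrderedModule ℝ Y] [HasSolidNorm Y] [CompleteSpace Y]
      (F : Type v) [NormedAddCommGroup F] [NormedSpace ℝ F] [FiniteDimensional ℝ F]
      (S : Y →L[ℝ] X) (R : E →L[ℝ] F), IsPositiveOp S → IsFiniteRank S →
        posNuclearNorm p (R ∘L T ∘L S) ≤ C * ‖R‖ₑ * ‖S‖ₑ) : PosIntegralBound p T C := by
  intro Y _ _ _ _ _ _ _ F _ _ _ S R hS hSf hRf
  have : FiniteDimensional ℝ (LinearMap.range (R : E →ₗ[ℝ] F)) := hRf
  let R' : E →L[ℝ] LinearMap.range (R : E →ₗ[ℝ] F) :=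
    R.codRestrict _ fun x => LinearMap.mem_range_self (R : E →ₗ[ℝ] F) x
  have hR' : ‖R'‖ ≤ ‖R‖ := R'.opNorm_le_bound (norm_nonneg _) fun x => R.le_opNorm x
  have h1 := posNuclearNorm_comp_le (p := p) (T := R' ∘L T ∘L S)
    (LinearMap.range (R : E →ₗ[ℝ] F)).subtypeL (Submodule.norm_subtypeL_le _)
  refine (h1.trans (h Y _ S R' hS hSf)).trans ?_
  gcongr
  exact enorm_le_iff_norm_le.2 hR'

variable [IsOrderedModule ℝ X] [HasSolidNorm X]

/-- A positively integral biadjoint has a positively integral pre-biadjoint. -/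
theorem PosIntegralBound.of_adj_adj {T : X →L[ℝ] E} (h : PosIntegralBound p (adj (adj T)) C) :
    PosIntegralBound p T C := by
  refine posIntegralBound_of_finiteDimensional fun Y _ _ _ _ _ _ _ F _ _ _ S R hS hSf => ?_
  obtain ⟨n, s, x, hs⟩ := hSf.exists_sum
  let J := NormedSpace.inclusionInDoubleDual ℝ X
  have h1 := h Y (StrongDual ℝ (StrongDual ℝ F)) (J ∘L S) (adj (adj R))
    (fun y hy f hf => hf _ (hS y hy))
    (isFiniteRank_of_sum (fun i y => s i y) (fun i => J (x i)) fun y => by simp [hs])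
    (isFiniteRank_of_finiteDimensional _)
  let L : StrongDual ℝ (StrongDual ℝ F) →L[ℝ] F :=
    (doubleDualEquiv F).symm.toLinearIsometry.toContinuousLinearMap
  -- Biadjoints extend the original operators, and `L` identifies `F**` with `F`.
  have e1 : R ∘L T ∘L S = L ∘L adj (adj R) ∘L adj (adj T) ∘L J ∘L S := by
    ext y
    change R (T (S y)) = (doubleDualEquiv F).symm _
    rw [LinearIsometryEquiv.eq_symm_apply]
    ext φ
    rfl
  rw [e1]
  have h2 : ‖adj (adj R)‖ₑ ≤ ‖R‖ₑ := enorm_le_iff_norm_le.2 ((norm_adj_le _).trans (norm_adj_le _))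
  have h3 : ‖J ∘L S‖ₑ ≤ ‖S‖ₑ := enorm_le_iff_norm_le.2 ((J.opNorm_comp_le S).trans
    (mul_le_of_le_one_left (norm_nonneg _) (NormedSpace.inclusionInDoubleDual_norm_le ℝ X)))
  have h4 := posNuclearNorm_comp_le (p := p) (T := adj (adj R) ∘L adj (adj T) ∘L J ∘L S) L
    (LinearIsometry.norm_toContinuousLinearMap_le _)
  exact h4.trans (h1.trans (mul_le_mul' (mul_le_mul' le_rfl h2) h3))

/-- If `T` is positively integral, its adjoint is latticially integral. -/
theorem PosIntegralBound.adj [CompleteSpace X] (hp : 1 ≤ p) (hX : HasPMAP (StrongDual ℝ X))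
    {T : X →L[ℝ] E} (h : PosIntegralBound p T C) : LatIntegralBound p (adj T) C := by
  intro F _ _ _ Y _ _ _ _ _ _ _ A B hA hB hBpos
  obtain ⟨n, a, y, hA'⟩ := hA.exists_sum
  let v : Fin n → StrongDual ℝ X := fun i => BanachLattice.adj T (y i)
  have key : ∀ δ : ℝ≥0, 0 < δ → latNuclearNorm p (B ∘L BanachLattice.adj T ∘L A) ≤
      ((‖B‖₊ + 2 * n * δ) * (C * ‖A‖₊ + δ + 2 * n * δ) : ℝ≥0) := by
    intro δ hδ
    have hδ' : (0 : ℝ) < δ := hδ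
    set M : ℝ := ∑ i, ‖a i‖ with hM
    have hM0 : 0 ≤ M := Finset.sum_nonneg fun i _ => norm_nonneg _
    -- Two approximations are made, so each error term has norm product at most `2 * η * M * ‖B‖ ≤ δ
    -- ^ 2`, as `HasRep.add_sum` requires.
    set η : ℝ := δ ^ 2 / (2 * (M * ‖B‖ + 1)) with hη
    have hη0 : 0 < η := by positivity
    obtain ⟨κ, _, e, x, he, hx, hS1, happ1⟩ := exists_adj_approx hX v hη0
    -- The second operator is needed because transposing a representation valid pointwise on `X`
    -- gives only weak* convergence in `X*`. It must be nearly the identity on the vectors `S* (v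
    -- i)`.
    obtain ⟨κ', _, e', x', he', hx', hS2, happ2⟩ :=
      exists_adj_approx hX (fun i => ∑ k, v i (x k) • e k) hη0
    set S : X →L[ℝ] X := ∑ k, (e k).smulRight (x k) with hS
    set S' : X →L[ℝ] X := ∑ k, (e' k).smulRight (x' k) with hS'
    have hSa : ∀ z, S z = ∑ k, e k z • x k := fun z => by simp [hS]
    have hSadj : ∀ f, BanachLattice.adj S f = ∑ k, f (x k) • e k := fun f => by
      ext z; simp [adj_apply, hSa, mul_comm]
    have hSadj' : ∀ f, BanachLattice.adj S' f = ∑ k, f (x' k) • e' k := fun f => by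
      ext z; simp [adj_apply, hS', mul_comm]
    have h1 := h X (StrongDual ℝ F) S A.flip
      (fun z hz => by
        rw [hSa]
        exact Finset.sum_nonneg fun k _ => smul_nonneg (he k z hz) (hx k))
      (isFiniteRank_of_sum (fun k z => e k z) x hSa) hA.flip
    have h2 : posNuclearNorm p (A.flip ∘L T ∘L S) < (C * ‖A‖₊ + δ : ℝ≥0) := by
      refine lt_of_le_of_lt h1 ?_
      have hS3 : ‖S‖ₑ ≤ 1 := by
        simpa using enorm_le_iff_norm_le (y := (1 : ℝ)) |>.2 (by simpa using hS1)
      rw [enorm_flip]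
      calc (C : ℝ≥0∞) * ‖A‖ₑ * ‖S‖ₑ ≤ C * ‖A‖ₑ * 1 := by gcongr
        _ = ((C * ‖A‖₊ : ℝ≥0) : ℝ≥0∞) := by rw [mul_one, ENNReal.coe_mul]; rfl
        _ < _ := by
          rw [ENNReal.coe_lt_coe]
          exact lt_add_of_pos_right _ hδ
    obtain ⟨f, w, hf, hfw, hw, hsum⟩ := hasRep_of_posNuclearNorm_lt hp h2
    have h3 : HasRep (ContinuousLinearMap.smulRightL ℝ F Y).flip p
        (B ∘L BanachLattice.adj S' ∘L BanachLattice.adj S ∘L BanachLattice.adj T ∘L A)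
        ‖B‖₊ (C * ‖A‖₊ + δ) := by
      refine ⟨fun j => (B ∘L BanachLattice.adj S') (f j), w, fun j => hBpos _ ?_, ?_, hw,
        fun z => ?_⟩
      · change 0 ≤ BanachLattice.adj S' (f j)
        rw [hSadj']
        exact Finset.sum_nonneg fun k _ => smul_nonneg (hf j _ (hx' k)) (he' k)
      · refine (weakSeqNorm_map_le (one_le_conjExponent p) _ f).trans ?_
        have h4 : ‖B ∘L BanachLattice.adj S'‖ₑ ≤ ‖B‖ₑ := enorm_le_iff_norm_le.2
          ((B.opNorm_comp_le _).trans (mul_le_of_le_one_right (norm_nonneg _)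
            ((norm_adj_le S').trans hS2)))
        exact (mul_le_mul' h4 hfw).trans_eq (by simp; rfl)
      -- Since `S'*` evaluates only at the finitely many points `x' k`, convergence there is enough
      -- for norm convergence in `Y`.
      · have h4 : ∀ k, HasSum (fun j => (f j (x' k) * w j z) • B (e' k))
            ((A z (T (S (x' k)))) • B (e' k)) := fun k => by
          have := (ContinuousLinearMap.apply ℝ ℝ z).hasSum (hsum (x' k))
          exact this.smul_const (B (e' k))
        have h5 := hasSum_sum (s := Finset.univ) fun k _ => h4 k
        convert h5 using 1
        · ext j
          simp [hSadj', smul_smul]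
        · simp only [ContinuousLinearMap.comp_apply]
          rw [hSadj']
          simp [adj_apply]
    let d : Fin n → Y := fun i => B (v i - BanachLattice.adj S' (BanachLattice.adj S (v i)))
    have hd : ∀ i ∈ Finset.univ, ‖d i‖₊ * ‖a i‖₊ ≤ δ ^ 2 := by
      intro i _
      rw [← NNReal.coe_le_coe]
      push_cast
      have t1 : ‖v i - BanachLattice.adj S' (BanachLattice.adj S (v i))‖ ≤ 2 * η := by
        have u1 := happ1 i
        have u2 := happ2 i
        rw [← hSadj (v i)] at u1 u2
        rw [← hSadj'] at u2
        rw [norm_sub_rev] at u1 u2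
        have := norm_add_le (v i - BanachLattice.adj S (v i))
          (BanachLattice.adj S (v i) - BanachLattice.adj S' (BanachLattice.adj S (v i)))
        rw [sub_add_sub_cancel] at this
        linarith
      have t2 : ‖d i‖ ≤ ‖B‖ * (2 * η) := B.le_of_opNorm_le_of_le le_rfl t1
      have t3 : ‖a i‖ ≤ M := Finset.single_le_sum (f := fun i => ‖a i‖)
        (fun j _ => norm_nonneg (a j)) (Finset.mem_univ i)
      have t4 : η * (2 * (M * ‖B‖ + 1)) = δ ^ 2 := div_mul_cancel₀ _ (by positivity)
      calc ‖d i‖ * ‖a i‖ ≤ ‖B‖ * (2 * η) * M := by gcongr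
        _ ≤ δ ^ 2 := by nlinarith
    have h6 := (HasRep.add_sum hp Finset.univ d a hδ hd h3).latNuclearNorm_le
    have e1 : B ∘L BanachLattice.adj S' ∘L BanachLattice.adj S ∘L BanachLattice.adj T ∘L A +
        ∑ i, (ContinuousLinearMap.smulRightL ℝ F Y).flip (d i) (a i)
        = B ∘L BanachLattice.adj T ∘L A := by
      ext z
      simp [hA', d, v, Finset.sum_sub_distrib]
    rw [e1, Finset.card_univ, Fintype.card_fin] at h6
    rw [ENNReal.coe_mul]
    exact h6
  refine (le_coe_of_forall_pos (g := fun δ => (‖B‖₊ + 2 * n * δ) * (C * ‖A‖₊ + δ + 2 * n * δ))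
    (by fun_prop) key).trans_eq ?_
  simp only [mul_zero, add_zero]
  rw [mul_comm, ENNReal.coe_mul, ENNReal.coe_mul]
  rfl

/-- If the adjoint of `T` is latticially integral, its biadjoint is positively integral. -/
theorem LatIntegralBound.adj {T : X →L[ℝ] E} (hp : 1 ≤ p) (h : LatIntegralBound p (adj T) C) :
    PosIntegralBound p (BanachLattice.adj (BanachLattice.adj T)) C := by
  refine posIntegralBound_of_finiteDimensional fun Z _ _ _ _ _ _ _ F _ _ _ S R hS hSf => ?_
  obtain ⟨n, s, ξ, hSs⟩ := hSf.exists_sum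
  let m : Fin n → StrongDual ℝ (StrongDual ℝ E) := fun i =>
    BanachLattice.adj (BanachLattice.adj T) (ξ i)
  let b := Module.finBasis ℝ F
  let ρ : Fin (Module.finrank ℝ F) → StrongDual ℝ (StrongDual ℝ (StrongDual ℝ E)) := fun k =>
    LinearMap.toContinuousLinearMap (b.coord k) ∘L R
  have hρ : ∀ z, ∑ k, ρ k z • b k = R z := fun z => b.sum_repr (R z)
  have key : ∀ δ : ℝ≥0, 0 < δ →
      posNuclearNorm p (R ∘L BanachLattice.adj (BanachLattice.adj T) ∘L S) ≤
      ((1 + 2 * n * δ) * (C * (‖R‖₊ + δ) * ‖S‖₊ + δ + 2 * n * δ) : ℝ≥0) := by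
    intro δ hδ
    have hδ' : (0 : ℝ) < δ := hδ
    set M : ℝ := ∑ i, ‖s i‖ with hM
    have hM0 : 0 ≤ M := Finset.sum_nonneg fun i _ => norm_nonneg _
    set D : ℝ := ∑ k, ‖b k‖ with hD
    have hD0 : 0 ≤ D := Finset.sum_nonneg fun i _ => norm_nonneg _
    -- The first bound keeps `‖A‖ ≤ ‖R‖ + δ`; the second makes the rank-one errors at most `δ ^ 2`.
    set η : ℝ := min δ (δ ^ 2 / (M * D + 1)) with hη
    have hη0 : 0 < η := by positivity
    -- With the whole space as cone only `w = 0` is nonnegative on it, so the positivity condition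
    -- is vacuous and this is local reflexivity for `E*`.
    obtain ⟨x, -, hA, hxm⟩ := exists_mem_cone_approx_norm_le (⊤ : PointedCone ℝ (StrongDual ℝ E))
      (ψ := ρ) (fun k w hw => by
        have : w = 0 := by
          ext z
          have h1 := hw z trivial
          have h2 := hw (-z) trivial
          rw [map_neg] at h2
          change w z = 0
          linarith
        rw [this, map_zero]) (fun k => doubleDualEquiv F (b k)) (norm_nonneg R)
      (fun w => by
        have : ∑ k, ρ k w • doubleDualEquiv F (b k) = doubleDualEquiv F (R w) := by
          rw [← hρ w, map_sum]
          exact Finset.sum_congr rfl fun k _ => (map_smul _ _ _).symm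
        rw [this, LinearIsometryEquiv.norm_map]
        exact R.le_opNorm w) m hη0
    set A : StrongDual ℝ F →L[ℝ] StrongDual ℝ E :=
      ∑ k, (doubleDualEquiv F (b k)).smulRight (x k) with hAdef
    have hAa : ∀ φ, A φ = ∑ k, φ (b k) • x k := fun φ => by
      simp [hAdef, doubleDualEquiv_apply]
    have h1 := h (StrongDual ℝ F) (StrongDual ℝ Z) A S.flip
      (isFiniteRank_of_sum (fun k φ => φ (b k)) x hAa) hSf.flip
      (fun f hf z hz => hS z hz f hf)
    have h2 : latNuclearNorm p (S.flip ∘L BanachLattice.adj T ∘L A)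
        < (C * (‖R‖₊ + δ) * ‖S‖₊ + δ : ℝ≥0) := by
      refine lt_of_le_of_lt h1 ?_
      have hA1 : ‖A‖ₑ ≤ ((‖R‖₊ + δ : ℝ≥0) : ℝ≥0∞) := by
        refine ENNReal.coe_le_coe.2 (NNReal.coe_le_coe.1 ?_)
        push_cast
        exact hA.trans (by gcongr; exact min_le_left _ _)
      rw [enorm_flip]
      calc (C : ℝ≥0∞) * ‖A‖ₑ * ‖S‖ₑ ≤ C * ((‖R‖₊ + δ : ℝ≥0) : ℝ≥0∞) * ‖S‖ₑ := by gcongr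
        _ = ((C * (‖R‖₊ + δ) * ‖S‖₊ : ℝ≥0) : ℝ≥0∞) := by
          rw [ENNReal.coe_mul, ENNReal.coe_mul]; rfl
        _ < _ := by
          rw [ENNReal.coe_lt_coe]
          exact lt_add_of_pos_right _ hδ
    obtain ⟨f, g, hf, hfw, hg, hsum⟩ := hasRep_of_latNuclearNorm_lt hp h2
    -- `R'` is the adjoint of `A` after `F** = F`, so `R' T** S` is the transpose of `S.flip T* A`,
    -- whose representation can be swapped factor by factor.
    let R' : StrongDual ℝ (StrongDual ℝ E) →L[ℝ] F :=
      ∑ k, (NormedSpace.inclusionInDoubleDual ℝ (StrongDual ℝ E) (x k)).smulRight (b k)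
    have hR' : ∀ ζ, R' ζ = ∑ k, ζ (x k) • b k := fun ζ => by simp [R']
    have h3 : HasRep (ContinuousLinearMap.smulRightL ℝ Z F) p
        (R' ∘L BanachLattice.adj (BanachLattice.adj T) ∘L S) 1
        (C * (‖R‖₊ + δ) * ‖S‖₊ + δ) := by
      refine ⟨f, fun j => (doubleDualEquiv F).symm (g j), hf, hfw,
        le_trans (seqNorm_mono fun j => ?_) hg, fun z => hasSum_of_forall_dual fun φ => ?_⟩
      · exact enorm_le_iff_norm_le.2 (LinearIsometryEquiv.norm_map _ _).le
      · have h4 : HasSum (fun j => g j φ * f j z) (S z (BanachLattice.adj T (A φ))) :=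
          (ContinuousLinearMap.apply ℝ ℝ z).hasSum (hsum φ)
        have e1 : ∀ j, φ (f j z • (doubleDualEquiv F).symm (g j)) = g j φ * f j z := fun j => by
          rw [map_smul, apply_doubleDualEquiv_symm, smul_eq_mul, mul_comm]
        have e2 : φ (R' (BanachLattice.adj (BanachLattice.adj T) (S z)))
            = S z (BanachLattice.adj T (A φ)) := by
          rw [hR', hAa, map_sum, map_sum, map_sum]
          refine Finset.sum_congr rfl fun k _ => ?_
          rw [map_smul, map_smul, map_smul, smul_eq_mul, smul_eq_mul, mul_comm]
          rfl
        change HasSum (fun j => φ (f j z • (doubleDualEquiv F).symm (g j)))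
          (φ (R' (BanachLattice.adj (BanachLattice.adj T) (S z))))
        rw [e2]
        simp only [e1]
        exact h4
    let d : Fin n → F := fun i => R (m i) - R' (m i)
    have hd : ∀ i ∈ Finset.univ, ‖s i‖₊ * ‖d i‖₊ ≤ δ ^ 2 := by
      intro i _
      rw [← NNReal.coe_le_coe]
      push_cast
      have t1 : ‖d i‖ ≤ η * D := by
        simp only [d]
        rw [hR', ← hρ, ← Finset.sum_sub_distrib, hD, Finset.mul_sum]
        refine norm_sum_le_of_le _ fun k _ => ?_
        rw [← sub_smul, norm_smul, norm_sub_rev]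
        exact mul_le_mul_of_nonneg_right (hxm i k).le (norm_nonneg _)
      have t3 : ‖s i‖ ≤ M := Finset.single_le_sum (f := fun i => ‖s i‖)
        (fun j _ => norm_nonneg (s j)) (Finset.mem_univ i)
      have t4 : η * (M * D + 1) ≤ δ ^ 2 := by
        rw [← le_div_iff₀ (by positivity)]
        exact min_le_right _ _
      calc ‖s i‖ * ‖d i‖ ≤ M * (η * D) := by gcongr
        _ ≤ δ ^ 2 := by nlinarith
    have h6 := (HasRep.add_sum hp Finset.univ s d hδ hd h3).posNuclearNorm_le
    have e1 : R' ∘L BanachLattice.adj (BanachLattice.adj T) ∘L S +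
        ∑ i, ContinuousLinearMap.smulRightL ℝ Z F (s i) (d i)
        = R ∘L BanachLattice.adj (BanachLattice.adj T) ∘L S := by
      ext z
      simp [hSs, d, m, smul_sub, Finset.sum_sub_distrib]
    rw [e1, Finset.card_univ, Fintype.card_fin] at h6
    rw [ENNReal.coe_mul]
    exact h6
  refine (le_coe_of_forall_pos
    (g := fun δ => (1 + 2 * n * δ) * (C * (‖R‖₊ + δ) * ‖S‖₊ + δ + 2 * n * δ))
    (by fun_prop) key).trans_eq ?_
  simp only [mul_zero, add_zero, one_mul]
  rw [ENNReal.coe_mul, ENNReal.coe_mul]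
  rfl

end Bounds

end BanachLattice

theorem corollary1p219
    {X : Type u} [NormedAddCommGroup X] [NormedSpace ℝ X] [Lattice X] [IsOrderedAddMonoid X]
    [IsOrderedModule ℝ X] [HasSolidNorm X] [CompleteSpace X]
    {E : Type v} [NormedAddCommGroup E] [NormedSpace ℝ E] [CompleteSpace E]
    (p : ℝ≥0∞) (hp : 1 ≤ p)
    (hX : BanachLattice.HasPMAP (StrongDual ℝ X)) (T : X →L[ℝ] E) :
    List.TFAE [
      BanachLattice.IsPosIntegral p T,
      BanachLattice.IsLatIntegral p (BanachLattice.adj T),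
      BanachLattice.IsPosIntegral p (BanachLattice.adj (BanachLattice.adj T))] ∧
    (BanachLattice.IsPosIntegral p T →
      BanachLattice.posIntegralNorm p T = BanachLattice.latIntegralNorm p (BanachLattice.adj T) ∧
      BanachLattice.latIntegralNorm p (BanachLattice.adj T) =
        BanachLattice.posIntegralNorm p (BanachLattice.adj (BanachLattice.adj T))) := by
  -- The admissible constants are the same for all three operators, which gives both the
  -- equivalences and the equality of the infima.
  have h12 : ∀ C, BanachLattice.PosIntegralBound p T C ↔
      BanachLattice.LatIntegralBound p (BanachLattice.adj T) C := fun C =>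
    ⟨fun h => h.adj hp hX, fun h => (h.adj hp).of_adj_adj⟩
  have h23 : ∀ C, BanachLattice.LatIntegralBound p (BanachLattice.adj T) C ↔
      BanachLattice.PosIntegralBound p (BanachLattice.adj (BanachLattice.adj T)) C := fun C =>
    ⟨fun h => h.adj hp, fun h => h.of_adj_adj.adj hp hX⟩
  refine ⟨?_, fun _ => ⟨?_, ?_⟩⟩
  · tfae_have 1 ↔ 2 := exists_congr h12
    tfae_have 2 ↔ 3 := exists_congr h23
    tfae_finish
  · simp only [BanachLattice.posIntegralNorm, BanachLattice.latIntegralNorm, h12]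
  · simp only [BanachLattice.posIntegralNorm, BanachLattice.latIntegralNorm, h23]
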